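/- Theorem. Let $(M,g,J)$ be a Kähler surface (a smooth manifold $M$ of real dimension $4$, with a smooth Riemannian metric $g$ and an integrable $g$-orthogonal almost complex structure $J$ whose Kähler form $\omega=g(J\cdot,\cdot)$ is closed). Suppose that $(M,g,J)$ is of Calabi type, that is, $M$ admits a nowhere vanishing Killing vector field $\xi$ that is Hamiltonian ($\omega(\xi,\cdot)=-dh$ for some smooth function $h$ on $M$) and such that the almost Hermitian pair $(g,I)$ is conformally Kähler, where $I=J$ on the distribution spanned by $\xi$ and $J\xi$ and $I=-J$ on its orthogonal complement; here $(g,I)$ is called conformally Kähler if $(fg,I)$ is Kähler for some smooth function $f>0$ on $M$. Then $(M,g,J)$ is a QCH Kähler surface: there is a global smooth $J$-invariant distribution $\mathcal D\subset TM$ of rank $2$ such that the holomorphic sectional curvature $R(X,JX,JX,X)$ of a unit tangent vector $X\in T_xM$ depends only on the point $x$ and on the length $|X_{\mathcal D}|$ of the orthogonal projection $X_{\mathcal D}$ of $X$ onto $\mathcal D_x$. Equivalently, there is a function $\phi:M\times\mathbb R\to\mathbb R$ with $R(X,JX,JX,X)=\phi(x,|X_{\mathcal D}|)$ for all $x\in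 M$ and all $X\in T_xM$ with $g(X,X)=1$. Here $R(X,Y,Z,W)=g(R(X,Y)Z,W)$ and $R(X,Y)=[\nabla_X,\nabla_Y]-\nabla_{[X,Y]}$ for the Levi-Civita connection $\nabla$ of $g$. -/

import Mathlib

open scoped Manifold ContDiff

noncomputable section

/-! ### Riemannian geometry on an open subset of a vector space

`G` is a field of bilinear forms, `A` a field of endomorphisms, `V` a vector field, all on (an open
subset of) the vector space `E`. -/

namespace LocalGeom

variable {E : Type*} [NormedAddCommGroup E] [NormedSpace ℝ E]

/-- The Christoffel symbol `Γ(u, v)` of the Levi-Civita connection of `G` at `y`, i.e. `∇_u v` for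
constant vector fields `u`, `v`:
`G(Γ(u, v), w) = (D_u G(v, w) + D_v G(u, w) - D_w G(u, v)) / 2` for all `w`. -/
def christoffel (G : E → E →L[ℝ] E →L[ℝ] ℝ) (y u v : E) : E :=
  (G y).inverse
    ((1 / 2 : ℝ) • (fderiv ℝ G y u v + fderiv ℝ G y v u - fderiv ℝ (fun z => G z u v) y))

/-- The Riemann curvature `R(u, v) w = ∇_u ∇_v w - ∇_v ∇_u w - ∇_[u, v] w` of `G` at `y`. -/
def curvature (G : E → E →L[ℝ] E →L[ℝ] ℝ) (y u v w : E) : E :=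
  fderiv ℝ (fun z => christoffel G z v w) y u - fderiv ℝ (fun z => christoffel G z u w) y v
    + christoffel G y u (christoffel G y v w) - christoffel G y v (christoffel G y u w)

/-- The Nijenhuis tensor `N(u, v) = [Au, Av] - A[Au, v] - A[u, Av] + A²[u, v]` of `A` at `y`,
evaluated on constant vector fields `u`, `v` (so that `[u, v] = 0`). -/
def nijenhuis (A : E → E →L[ℝ] E) (y u v : E) : E :=
  VectorField.lieBracket ℝ (fun z => A z u) (fun z => A z v) y
    - A y (VectorField.lieBracket ℝ (fun z => A z u) (fun _ => v) y)
    - A y (VectorField.lieBracket ℝ (fun _ => u) (fun z => A z v) y)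

/-- The value `dΩ(u, v, w)` at `y` of the exterior derivative of a `2`-form `Ω`. -/
def extDerivTwoForm (Ω : E → E → E → ℝ) (y u v w : E) : ℝ :=
  fderiv ℝ (fun z => Ω z v w) y u + fderiv ℝ (fun z => Ω z w u) y v
    + fderiv ℝ (fun z => Ω z u v) y w

/-- The value `(L_V G)(u, v)` at `y` of the Lie derivative of `G` along `V`. -/
def lieDerivMetric (G : E → E →L[ℝ] E →L[ℝ] ℝ) (V : E → E) (y u v : E) : ℝ :=
  fderiv ℝ (fun z => G z u v) y (V y) + G y (fderiv ℝ V y u) v + G y u (fderiv ℝ V y v)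

end LocalGeom

/-! ### Tensors on a manifold and their expressions in charts

`M` is a manifold without boundary modelled on the vector space `E`. -/

namespace ManifoldGeom

variable {E : Type*} [NormedAddCommGroup E] [NormedSpace ℝ E]
  {M : Type*} [TopologicalSpace M] [ChartedSpace E M]

/-- A (not necessarily smooth) vector field on `M`. -/
abbrev VField (E M : Type*) [NormedAddCommGroup E] [NormedSpace ℝ E] [TopologicalSpace M]
    [ChartedSpace E M] : Type _ :=
  ∀ x : M, TangentSpace 𝓘(ℝ, E) x

/-- A (not necessarily smooth) field of endomorphisms of the tangent spaces of `M`. -/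
abbrev EndField (E M : Type*) [NormedAddCommGroup E] [NormedSpace ℝ E] [TopologicalSpace M]
    [ChartedSpace E M] : Type _ :=
  ∀ x : M, TangentSpace 𝓘(ℝ, E) x →L[ℝ] TangentSpace 𝓘(ℝ, E) x

/-- A smooth Riemannian metric on `M`. -/
abbrev SmoothMetric (E M : Type*) [NormedAddCommGroup E] [NormedSpace ℝ E] [TopologicalSpace M]
    [ChartedSpace E M] [IsManifold 𝓘(ℝ, E) ∞ M] : Type _ :=
  Bundle.ContMDiffRiemannianMetric 𝓘(ℝ, E) ∞ E (fun x : M => TangentSpace 𝓘(ℝ, E) x)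

/-- The (open) image in `E` of the preferred chart at `p`. -/
def chartTarget (E : Type*) [NormedAddCommGroup E] [NormedSpace ℝ E] {M : Type*}
    [TopologicalSpace M] [ChartedSpace E M] (p : M) : Set E :=
  (extChartAt 𝓘(ℝ, E) p).target

/-- The inverse of the preferred chart at `p`. -/
def chartInv (p : M) : E → M := (extChartAt 𝓘(ℝ, E) p).symm

/-- The derivative at `y` of the inverse of the preferred chart at `p`. -/
def chartFrame (p : M) (y : E) : E →L[ℝ] TangentSpace 𝓘(ℝ, E) (chartInv p y) :=
  mfderiv 𝓘(ℝ, E) 𝓘(ℝ, E) (chartInv p) y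

/-- A vector field in the preferred chart at `p`. -/
def vectorInChart (ξ : VField E M) (p : M) (y : E) : E :=
  (chartFrame p y).inverse (ξ (chartInv p y))

/-- A field of endomorphisms in the preferred chart at `p`. -/
def endInChart (J : EndField E M) (p : M) (y : E) : E →L[ℝ] E :=
  (chartFrame p y).inverse.comp ((J (chartInv p y)).comp (chartFrame p y))

/-- Smoothness of a vector field on a subset of `M`. -/
def SmoothVFieldOn [IsManifold 𝓘(ℝ, E) ∞ M] (ξ : VField E M) (U : Set M) : Prop :=
  ContMDiffOn 𝓘(ℝ, E) (𝓘(ℝ, E).prod 𝓘(ℝ, E)) ∞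
    (fun x => Bundle.TotalSpace.mk' E (E := fun x : M => TangentSpace 𝓘(ℝ, E) x) x (ξ x)) U

/-- Smoothness of a field of endomorphisms. -/
def SmoothEndField [IsManifold 𝓘(ℝ, E) ∞ M] (J : EndField E M) : Prop :=
  ContMDiff 𝓘(ℝ, E) (𝓘(ℝ, E).prod 𝓘(ℝ, E →L[ℝ] E)) ∞
    (fun x => Bundle.TotalSpace.mk' (E →L[ℝ] E)
      (E := fun x : M => TangentSpace 𝓘(ℝ, E) x →L[ℝ] TangentSpace 𝓘(ℝ, E) x) x (J x))

variable [IsManifold 𝓘(ℝ, E) ∞ M]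

/-- A Riemannian metric in the preferred chart at `p`. -/
def metricInChart (g : SmoothMetric E M) (p : M) (y : E) : E →L[ℝ] E →L[ℝ] ℝ :=
  (ContinuousLinearMap.precomp ℝ (chartFrame p y)).comp
    ((g.inner (chartInv p y)).comp (chartFrame p y))

/-- The curvature tensor `R(X, Y, Z, W) = g(R(X, Y) Z, W)` at `x`, where `R(X, Y)` is the
commutator `[∇_X, ∇_Y] - ∇_[X, Y]` for the Levi-Civita connection `∇`; computed in the preferred
chart at `x`. -/
def riemann (g : SmoothMetric E M) (x : M) (X Y Z W : TangentSpace 𝓘(ℝ, E) x) : ℝ :=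
  let d : TangentSpace 𝓘(ℝ, E) x →L[ℝ] E := mfderiv 𝓘(ℝ, E) 𝓘(ℝ, E) (extChartAt 𝓘(ℝ, E) x) x
  let y : E := extChartAt 𝓘(ℝ, E) x x
  metricInChart g x y (LocalGeom.curvature (metricInChart g x) y (d X) (d Y) (d Z)) (d W)

/-- `J` is a smooth almost complex structure, orthogonal for the metric `g`. -/
structure IsAlmostHermitian (g : SmoothMetric E M) (J : EndField E M) : Prop where
  smooth : SmoothEndField J
  sq : ∀ (x : M) (v : TangentSpace 𝓘(ℝ, E) x), J x (J x v) = -v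
  orthogonal : ∀ (x : M) (v w : TangentSpace 𝓘(ℝ, E) x),
    g.inner x (J x v) (J x w) = g.inner x v w

/-- `(g, J)` is a Kähler structure: it is almost Hermitian, `J` is integrable (its Nijenhuis tensor
vanishes), and the Kähler form `Ω = g(J·, ·)` is closed. -/
structure IsKahler (g : SmoothMetric E M) (J : EndField E M) : Prop
    extends IsAlmostHermitian g J where
  integrable : ∀ (p : M), ∀ y ∈ chartTarget E p, ∀ u v : E,
    LocalGeom.nijenhuis (endInChart J p) y u v = 0
  closed : ∀ (p : M), ∀ y ∈ chartTarget E p, ∀ u v w : E,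
    LocalGeom.extDerivTwoForm
      (fun z a b => metricInChart g p z (endInChart J p z a) b) y u v w = 0

/-- `(g, I)` is conformally Kähler: `f g` is Kähler with respect to `I` for some smooth positive
function `f` on `M`. -/
def IsConformallyKahler (g : SmoothMetric E M) (I : EndField E M) : Prop :=
  ∃ (f : M → ℝ) (g' : SmoothMetric E M), ContMDiff 𝓘(ℝ, E) 𝓘(ℝ, ℝ) ∞ f ∧ (∀ x, 0 < f x) ∧
    (∀ (x : M) (v w : TangentSpace 𝓘(ℝ, E) x), g'.inner x v w = f x * g.inner x v w) ∧
    IsKahler g' I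

/-- `ξ` is a Killing vector field: the Lie derivative of `g` along `ξ` vanishes. -/
def IsKilling (g : SmoothMetric E M) (ξ : VField E M) : Prop :=
  SmoothVFieldOn ξ Set.univ ∧ ∀ (p : M), ∀ y ∈ chartTarget E p, ∀ u v : E,
    LocalGeom.lieDerivMetric (metricInChart g p) (vectorInChart ξ p) y u v = 0

/-- `ξ` is Hamiltonian for the Kähler form `Ω = g(J·, ·)`: there is a smooth function `h` on `M`
with `Ω(ξ, ·) = -dh`. -/
def IsHamiltonian (g : SmoothMetric E M) (J : EndField E M) (ξ : VField E M) : Prop :=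
  ∃ h : M → ℝ, ContMDiff 𝓘(ℝ, E) 𝓘(ℝ, ℝ) ∞ h ∧ ∀ (x : M) (v : TangentSpace 𝓘(ℝ, E) x),
    g.inner x (J x (ξ x)) v = -(mfderiv 𝓘(ℝ, E) 𝓘(ℝ, ℝ) h x v : ℝ)

/-- Calabi type: there are a nowhere vanishing Hamiltonian Killing vector field `ξ` and a field `I`
of endomorphisms, equal to `J` on the span of `ξ` and `Jξ` and to `-J` on the orthogonal complement
of that span, such that `(g, I)` is conformally Kähler. -/
def IsCalabiType (g : SmoothMetric E M) (J : EndField E M) : Prop :=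
  ∃ (ξ : VField E M) (I : EndField E M), (∀ x, ξ x ≠ 0) ∧ IsKilling g ξ ∧ IsHamiltonian g J ξ ∧
    (∀ (x : M), ∀ v ∈ Submodule.span ℝ {ξ x, J x (ξ x)}, I x v = J x v) ∧
    (∀ (x : M) (w : TangentSpace 𝓘(ℝ, E) x),
      (∀ v ∈ Submodule.span ℝ {ξ x, J x (ξ x)}, g.inner x w v = 0) → I x w = -J x w) ∧
    IsConformallyKahler g I

/-- A smooth distribution of planes on `M`: a family of `2`-dimensional subspaces of the tangent
spaces that is locally spanned by two smooth vector fields. -/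
structure IsPlaneDistribution (D : ∀ x : M, Submodule ℝ (TangentSpace 𝓘(ℝ, E) x)) : Prop where
  finrank_eq : ∀ x, Module.finrank ℝ (D x) = 2
  smooth : ∀ x : M, ∃ (U : Set M) (X Y : VField E M), IsOpen U ∧ x ∈ U ∧
    SmoothVFieldOn X U ∧ SmoothVFieldOn Y U ∧ ∀ z ∈ U, D z = Submodule.span ℝ {X z, Y z}

/-- QCH (quasi-constant holomorphic sectional curvature): there is a `J`-invariant smooth
distribution `D` of planes such that the holomorphic sectional curvature `R(X, JX, JX, X)` of a unit
vector `X` depends only on its base point `x` and on the length of the orthogonal projection of `X`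
to `D`. Here `X = a + b` with `a` in `D` and `b` orthogonal to `D`, so `a` is that projection. -/
def IsQCH (g : SmoothMetric E M) (J : EndField E M) : Prop :=
  ∃ D : ∀ x : M, Submodule ℝ (TangentSpace 𝓘(ℝ, E) x), IsPlaneDistribution D ∧
    (∀ (x : M), ∀ v ∈ D x, J x v ∈ D x) ∧
    ∃ φ : M → ℝ → ℝ, ∀ (x : M) (X a b : TangentSpace 𝓘(ℝ, E) x),
      X = a + b → a ∈ D x → (∀ v ∈ D x, g.inner x b v = 0) → g.inner x X X = 1 →
        riemann g x X (J x X) (J x X) X = φ x (Real.sqrt (g.inner x a a))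

end ManifoldGeom

end

set_option maxSynthPendingDepth 3

/-! ### Pointwise linear algebra -/

namespace LocalGeom

/-! The distribution is `D = span {ξ, Jξ}`, and the claim is about the curvature at one point, so
everything is computed in a chart.

Put `A = ∇ξ`. It is skew because `ξ` is Killing, and it commutes with `J` because `g(JA·,·)` is
minus the Hessian of `h`, hence symmetric (`covVec_skew`, `covVec_comm`). Since `f g` is Kähler for
`I`, the tensor `∇I` is an algebraic expression in the form `θ = d log f / 2` (`covEnd_eq`).
Differentiating `Iξ = Jξ` therefore expresses `JA - IA` through `θ`. This linear system forces `θ =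
t g(Jξ,·)` and `A = αJ + βI`, where `α + β = l` is the ratio of `∇_ξ ξ` to `Jξ`, and `α - β =
t|ξ|²/2` (`calabi_structure`).

As `g(Jξ,·) = -dh`, one gets `d|ξ|² = 2l dh` and `d log f = -2t dh`. Applying `d` once more makes
`dl` and `dt`, hence `dα` and `dβ`, multiples of `dh`. Now `∇J = 0` and `∇I` is known, so `R(u,v)ξ =
(∇_u A)v - (∇_v A)u` is explicit (`exists_curvature_vec`).

For vectors orthogonal to `D` this formula gives `R(b,c,ξ,d) = 0`, `R(ξ,Jξ,ξ,b) = 0` and `R(ξ,b,ξ,c)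
= m g(b,c)`. With the symmetries of a Kähler curvature tensor, the holomorphic curvature of `a + b`,
`a ∈ D`, `b ⟂ D`, becomes `P|a|⁴ + Q|a|²|b|² + S|b|⁴` (`holomorphic_eq`, `exists_holomorphic`). The
last term has this form because in real dimension four `D^⊥` is a single complex line. For a unit
vector `|b|² = 1 - |a|²`, which leaves a function of `|a|`. -/

/-- The algebraic fact behind `∇J = 0` for Kähler structures: the only tensor with the symmetries of
`G((∇_u J) v, w)` whose associated exterior derivative and Nijenhuis tensor vanish is zero. -/
theorem trilinear_eq_zero {E : Type*} [AddCommGroup E] (T : E → E → E → ℝ) (I : E → E)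
    (sq : ∀ v, I (I v) = -v) (neg : ∀ u v w, T (-u) v w = -T u v w)
    (skew : ∀ u v w, T u v w = -T u w v) (cyc : ∀ u v w, T u v w + T v w u + T w u v = 0)
    (nij : ∀ u v w, T (I u) v w - T (I v) u w + T u v (I w) - T v u (I w) = 0) (u v w : E) :
    T u v w = 0 := by
  have key : ∀ u v w, T (I u) v w = 0 := by
    intro u v w
    -- The Nijenhuis identity at `(u, v, w)` and the cyclic identity at `(u, v, I w)` share two
    -- terms; eliminating them leaves `e1`. Two instances of `e1` then give `T (I u) v w = -T (I u)
    -- v w`.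
    have e1 : ∀ u v w, T (I u) v w = T (I v) u w + T (I w) u v := by
      intro u v w
      linarith [nij u v w, cyc u v (I w), skew v (I w) u]
    linarith [e1 u v w, e1 w u v, skew (I u) v w, skew (I v) u w]
  have h := key (I u) v w
  rw [sq, neg] at h
  linarith

variable {E : Type*} [NormedAddCommGroup E] [NormedSpace ℝ E]

/-- The value of `G((∇_u I) v, w)` for a conformally Kähler structure with Lee form `-2 θ`. -/
noncomputable def leeTensor (G : E →L[ℝ] E →L[ℝ] ℝ) (I : E →L[ℝ] E) (θ : E →L[ℝ] ℝ) (u v w : E) : ℝ :=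
  -θ (I v) * G u w + θ (I w) * G u v + θ w * G u (I v) - θ v * G u (I w)

/-- `leeTensor` is a particular solution of these inhomogeneous linear conditions, and
`trilinear_eq_zero` says that the homogeneous system has only the zero solution. -/
theorem eq_leeTensor {G : E →L[ℝ] E →L[ℝ] ℝ} {I : E →L[ℝ] E} {θ : E →L[ℝ] ℝ}
    (symm : ∀ v w, G v w = G w v) (sq : ∀ v, I (I v) = -v) (orth : ∀ v w, G (I v) (I w) = G v w)
    (T : E → E → E → ℝ) (neg : ∀ u v w, T (-u) v w = -T u v w)
    (skew : ∀ u v w, T u v w = -T u w v)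
    (cyc : ∀ u v w, T u v w + T v w u + T w u v =
      -2 * (θ u * G (I v) w + θ v * G (I w) u + θ w * G (I u) v))
    (nij : ∀ u v w, T (I u) v w - T (I v) u w + T u v (I w) - T v u (I w) = 0) (u v w : E) :
    T u v w = leeTensor G I θ u v w := by
  have sk : ∀ v w, G (I v) w = -G v (I w) := by
    intro v w
    rw [← orth v (I w), sq]; simp
  refine sub_eq_zero.1 (trilinear_eq_zero (fun u v w => T u v w - leeTensor G I θ u v w) I sq
    ?_ ?_ ?_ ?_ u v w)
  · intro u v w
    simp only [neg, leeTensor, map_neg, neg_apply]; ring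
  · intro u v w
    rw [skew u v w]; simp only [leeTensor]; ring
  · intro u v w
    have := cyc u v w
    simp only [leeTensor]
    rw [sk, sk, sk] at this
    rw [symm v u, symm w u, symm w v, symm v (I u), symm w (I v), symm w (I u), ← neg_neg (G (I u) v),
      ← neg_neg (G (I v) w), ← neg_neg (G (I u) w), sk, sk, sk]
    rw [symm w (I u), sk] at this
    linear_combination this
  · intro u v w
    have := nij u v w
    simp only [leeTensor, sq, map_neg, orth, sk]
    rw [symm v u, symm v (I u), sk]
    linear_combination this

section Frame

variable {G : E →L[ℝ] E →L[ℝ] ℝ} {J : E →L[ℝ] E} {ξ : E}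

theorem frame_decomposition (symm : ∀ v w, G v w = G w v) (pos : 0 < G ξ ξ)
    (sq : ∀ v, J (J v) = -v) (orth : ∀ v w, G (J v) (J w) = G v w) (v : E) :
    ∃ (x y : ℝ) (b : E), v = x • ξ + y • J ξ + b ∧ G b ξ = 0 ∧ G b (J ξ) = 0 := by
  have h0 : G ξ (J ξ) = 0 := by
    have h1 := orth ξ (J ξ)
    rw [sq, map_neg, symm] at h1
    linarith
  refine ⟨G v ξ / G ξ ξ, G v (J ξ) / G ξ ξ, v - ((G v ξ / G ξ ξ) • ξ + (G v (J ξ) / G ξ ξ) • J ξ),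
    by abel, ?_, ?_⟩
  · simp [symm (J ξ) ξ, h0, pos.ne']
  · simp [h0, orth, pos.ne']

theorem clm_ext_frame {F : Type*} [NormedAddCommGroup F] [NormedSpace ℝ F]
    (symm : ∀ v w, G v w = G w v) (pos : 0 < G ξ ξ)
    (sq : ∀ v, J (J v) = -v) (orth : ∀ v w, G (J v) (J w) = G v w) {L L' : E →L[ℝ] F}
    (h1 : L ξ = L' ξ) (h2 : L (J ξ) = L' (J ξ))
    (h3 : ∀ b, G b ξ = 0 → G b (J ξ) = 0 → L b = L' b) : L = L' := by
  ext v
  obtain ⟨x, y, b, rfl, hb1, hb2⟩ := frame_decomposition symm pos sq orth v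
  simp [h1, h2, h3 b hb1 hb2]

/-- The covariant derivative `A` of a Hamiltonian Killing field `ξ` on a Kähler surface of Calabi
type, and the Lee form, are determined by two scalars. -/
theorem calabi_structure {I A : E →L[ℝ] E} {θ : E →L[ℝ] ℝ}
    (symm : ∀ v w, G v w = G w v) (posd : ∀ v, v ≠ 0 → 0 < G v v) (hξ : ξ ≠ 0)
    (sq : ∀ v, J (J v) = -v) (orth : ∀ v w, G (J v) (J w) = G v w)
    (hI1 : I ξ = J ξ) (hI2 : I (J ξ) = -ξ)
    (hI3 : ∀ b, G b ξ = 0 → G b (J ξ) = 0 → I b = -J b)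
    (exists_perp : ∃ b, b ≠ 0 ∧ G b ξ = 0 ∧ G b (J ξ) = 0)
    (skew : ∀ u v, G (A u) v = -G u (A v)) (comm : ∀ u, A (J u) = J (A u))
    (lee : ∀ u w, G (J (A u) - I (A u)) w = leeTensor G I θ u ξ w) :
    (∀ u, θ u = θ (J ξ) / G ξ ξ * G (J ξ) u) ∧
    ∀ u, A u = ((G (A ξ) (J ξ) / G ξ ξ + θ (J ξ) / 2) / 2) • J u +
      ((G (A ξ) (J ξ) / G ξ ξ - θ (J ξ) / 2) / 2) • I u := by
  have pos := posd ξ hξ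
  have skJ : ∀ v w, G (J v) w = -G v (J w) := by
    intro v w
    rw [← orth v (J w), sq]; simp
  have h0 : G ξ (J ξ) = 0 := by
    have h1 := skJ ξ ξ
    rw [symm] at h1
    linarith
  have hp1 : ∀ b, G b ξ = 0 → G b (J ξ) = 0 → G (J b) ξ = 0 ∧ G (J b) (J ξ) = 0 := by
    intro b h1 h2
    exact ⟨by rw [skJ, h2, neg_zero], by rw [orth, h1]⟩
  -- pairing with a vector orthogonal to `ξ` and `J ξ`
  have lee2 : ∀ u w, G w ξ = 0 → G w (J ξ) = 0 → 2 * G (A u) w = leeTensor G I θ u ξ (J w) := by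
    intro u w h1 h2
    obtain ⟨h3, h4⟩ := hp1 w h1 h2
    have hIw : I (J w) = w := by rw [hI3 _ h3 h4, sq, neg_neg]
    rw [← lee]
    -- On the complement `I` is `-J`, so `J` and `I` contribute `G(Au, w)` and `-G(Au, w)` when
    -- paired with `J w`; this is the source of the factor 2. Orthogonality of `I` is not among the
    -- hypotheses, hence the check on the frame.
    have e : ∀ v, G (I v) (J w) = -G v w := by
      have : (G.flip (J w)).comp I = -G.flip w := by
        apply clm_ext_frame symm pos sq orth
        · simp [hI1, orth, symm ξ w, h1]
        · simp [hI2, symm ξ (J w), h3, symm (J ξ) w, h2]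
        · intro b hb1 hb2
          simp [hI3 b hb1 hb2, orth]
      intro v
      exact DFunLike.congr_fun this v
    simp only [map_sub, sub_apply, orth, e]
    ring
  have hJq : G (J ξ) (J ξ) = G ξ ξ := orth ξ ξ
  -- Testing `u = ξ` with `w` and `u = Jξ` with `J w` gives the same left side, as `A` commutes with
  -- `J`, but right sides `|ξ|² θ(w)` and `-|ξ|² θ(w)`. So both vanish.
  have hθ : ∀ w, G w ξ = 0 → G w (J ξ) = 0 → θ w = 0 ∧ G (A ξ) w = 0 := by
    intro w h1 h2
    obtain ⟨h3, h4⟩ := hp1 w h1 h2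
    have a1 := lee2 ξ w h1 h2
    have a2 := lee2 (J ξ) (J w) h3 h4
    have hIw : I (J w) = w := by rw [hI3 _ h3 h4, sq, neg_neg]
    have hIw' : I w = -J w := hI3 _ h1 h2
    simp only [leeTensor, comm, orth, sq, map_neg, hI1, hIw, hIw', h0,
      symm ξ w, symm ξ (J w), symm (J ξ) w, symm (J ξ) ξ, h1, h2, h3] at a1 a2
    have : G ξ ξ * θ w = 0 := by linarith
    have h5 : θ w = 0 := (mul_eq_zero.1 this).resolve_left pos.ne'
    refine ⟨h5, ?_⟩
    rw [h5] at a1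
    linarith
  have hmid : ∀ b w, G b ξ = 0 → G b (J ξ) = 0 → G w ξ = 0 → G w (J ξ) = 0 →
      2 * G (A b) w = -θ (J ξ) * G b (J w) - θ ξ * G b w := by
    intro b w h1 h2 h3 h4
    obtain ⟨h5, h6⟩ := hp1 w h3 h4
    have hIw : I (J w) = w := by rw [hI3 _ h5 h6, sq, neg_neg]
    rw [lee2 b w h3 h4]
    simp only [leeTensor, hI1, hIw, h1, h2]
    ring
  -- By `hmid`, the form `G(A·,·)` on the complement has symmetric part proportional to `θ ξ`.
  -- Skewness of `A` kills it once the complement is nonzero.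
  have hθξ : θ ξ = 0 := by
    obtain ⟨b, hb, h1, h2⟩ := exists_perp
    have h3 := hmid b b h1 h2 h1 h2
    have h4 := skew b b
    rw [symm] at h4
    have h5 : G b (J b) = 0 := by
      have := skJ b b
      rw [symm] at this
      linarith
    rw [symm, h5] at h3
    have : θ ξ * G b b = 0 := by linarith
    exact (mul_eq_zero.1 this).resolve_right (posd b hb).ne'
  have hAξ : G (A ξ) ξ = 0 := by
    have := skew ξ ξ
    rw [symm ξ (A ξ)] at this
    linarith
  have ext0 : ∀ v v' : E, (∀ w, G v w = G v' w) → v = v' := by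
    intro v v' h
    by_contra hne
    have := posd (v - v') (sub_ne_zero.2 hne)
    simp only [map_sub, sub_apply, h] at this
    simp at this
  have hA1 : A ξ = (G (A ξ) (J ξ) / G ξ ξ) • J ξ := by
    apply ext0
    intro w
    refine DFunLike.congr_fun (?_ : G (A ξ) = G ((G (A ξ) (J ξ) / G ξ ξ) • J ξ)) w
    apply clm_ext_frame symm pos sq orth
    · simp [hAξ, symm (J ξ) ξ, h0]
    · simp [hJq, pos.ne']
    · intro b h1 h2
      simp [(hθ b h1 h2).2, symm (J ξ) b, h2]
  refine ⟨?_, ?_⟩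
  · intro u
    refine DFunLike.congr_fun (?_ : θ = (θ (J ξ) / G ξ ξ) • G (J ξ)) u
    apply clm_ext_frame symm pos sq orth
    · simp [hθξ, symm (J ξ) ξ, h0]
    · simp [hJq, pos.ne']
    · intro b h1 h2
      simp [(hθ b h1 h2).1, symm (J ξ) b, h2]
  -- `J` and `I` agree on the plane of `ξ`, `Jξ` and are opposite on its complement. So the
  -- coefficients are fixed by their sum, `l`, and their difference, `θ(Jξ)/2`.
  · generalize hl : G (A ξ) (J ξ) / G ξ ξ = l at hA1 ⊢
    intro u
    refine DFunLike.congr_fun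
      (?_ : A = ((l + θ (J ξ) / 2) / 2) • J + ((l - θ (J ξ) / 2) / 2) • I) u
    apply clm_ext_frame symm pos sq orth
    · simp only [add_apply, smul_apply, hI1, hA1]
      module
    · simp only [add_apply, smul_apply, hI2, sq, comm, hA1,
        map_smul]
      module
    · intro b h1 h2
      have hIb : I b = -J b := hI3 b h1 h2
      simp only [add_apply, smul_apply, hIb]
      have : ((l + θ (J ξ) / 2) / 2) • J b + ((l - θ (J ξ) / 2) / 2) • -J b
          = (θ (J ξ) / 2) • J b := by module
      rw [this]
      obtain ⟨h3, h4⟩ := hp1 b h1 h2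
      apply ext0
      intro w
      refine DFunLike.congr_fun (?_ : G (A b) = G ((θ (J ξ) / 2) • J b)) w
      apply clm_ext_frame symm pos sq orth
      · simp [skew, hA1, h2, h3]
      · simp [skew, hA1, comm, h1, h4, sq]
      · intro c h5 h6
        have := hmid b c h1 h2 h5 h6
        simp only [map_smul, smul_apply, smul_eq_mul, skJ]
        rw [hθξ] at this
        linarith

end Frame

end LocalGeom

/-! ### Algebraic curvature tensors of Kähler type -/

namespace LocalGeom

/-- The algebraic symmetries of the curvature tensor `R(u, v, w, z) = g(R(u, v) w, z)` of a Kähler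
metric. -/
structure IsKahlerCurvature {E : Type*} [AddCommGroup E] [Module ℝ E] (J : E → E)
    (R : E → E → E → E → ℝ) : Prop where
  add : ∀ u u' v w z, R (u + u') v w z = R u v w z + R u' v w z
  smul : ∀ (c : ℝ) u v w z, R (c • u) v w z = c * R u v w z
  skew_left : ∀ u v w z, R u v w z = -R v u w z
  skew_right : ∀ u v w z, R u v w z = -R u v z w
  bianchi : ∀ u v w z, R u v w z + R v w u z + R w u v z = 0
  J_right : ∀ u v w z, R u v (J w) (J z) = R u v w z

namespace IsKahlerCurvature

variable {E : Type*} [AddCommGroup E] [Module ℝ E] {J : E →ₗ[ℝ] E} {R : E → E → E → E → ℝ}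

/-- The classical octahedron argument: a combination of four Bianchi identities, one for each cyclic
rotation of the arguments. It transfers linearity and `J`-invariance to the remaining slots. -/
theorem pair_symm (h : IsKahlerCurvature J R) (u v w z : E) : R u v w z = R w z u v := by
  have b := h.bianchi
  have l := h.skew_left
  have r := h.skew_right
  linarith [b u v w z, b v w z u, b w z u v, b z u v w, l u v w z, r u v w z, l v w u z, r v w u z,
    l w u v z, r w u v z, l v w z u, l w z v u, r w z v u, r z v w u, l z v w u, l w z u v,
    r w z u v, r z u w v, l z u w v, r u w z v, l u w z v, l z u v w, l u v z w, l v z u w,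
    r v z u w, r u v z w, r v w z u, l v w z u]

theorem J_left (h : IsKahlerCurvature J R) (u v w z : E) : R (J u) (J v) w z = R u v w z := by
  rw [h.pair_symm, h.J_right, h.pair_symm]

theorem add₂ (h : IsKahlerCurvature J R) (u v v' w z : E) :
    R u (v + v') w z = R u v w z + R u v' w z := by
  rw [h.skew_left, h.add, h.skew_left v, h.skew_left v']; ring

theorem smul₂ (h : IsKahlerCurvature J R) (c : ℝ) (u v w z : E) :
    R u (c • v) w z = c * R u v w z := by
  rw [h.skew_left, h.smul, h.skew_left v]; ring

theorem add₃ (h : IsKahlerCurvature J R) (u v w w' z : E) :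
    R u v (w + w') z = R u v w z + R u v w' z := by
  rw [h.pair_symm, h.add, h.pair_symm w, h.pair_symm w']

theorem smul₃ (h : IsKahlerCurvature J R) (c : ℝ) (u v w z : E) :
    R u v (c • w) z = c * R u v w z := by
  rw [h.pair_symm, h.smul, h.pair_symm w]

theorem add₄ (h : IsKahlerCurvature J R) (u v w z z' : E) :
    R u v w (z + z') = R u v w z + R u v w z' := by
  rw [h.pair_symm, h.add₂, h.pair_symm w, h.pair_symm w]

theorem smul₄ (h : IsKahlerCurvature J R) (c : ℝ) (u v w z : E) :
    R u v w (c • z) = c * R u v w z := by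
  rw [h.pair_symm, h.smul₂, h.pair_symm w]

theorem neg₁ (h : IsKahlerCurvature J R) (u v w z : E) : R (-u) v w z = -R u v w z := by
  rw [← neg_one_smul ℝ, h.smul]; ring

theorem neg₂ (h : IsKahlerCurvature J R) (u v w z : E) : R u (-v) w z = -R u v w z := by
  rw [← neg_one_smul ℝ, h.smul₂]; ring

theorem neg₃ (h : IsKahlerCurvature J R) (u v w z : E) : R u v (-w) z = -R u v w z := by
  rw [← neg_one_smul ℝ, h.smul₃]; ring

theorem J_swap (h : IsKahlerCurvature J R) (sq : ∀ v, J (J v) = -v) (u v w z : E) :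
    R u v (J w) z = -R u v w (J z) := by
  rw [← h.J_right, sq, h.neg₃]

theorem J_swap_left (h : IsKahlerCurvature J R) (sq : ∀ v, J (J v) = -v) (u v w z : E) :
    R (J u) v w z = -R u (J v) w z := by
  rw [← h.J_left, sq, h.neg₁]

/-- The holomorphic sectional curvature of a sum, when the mixed terms of odd degree vanish. -/
theorem holomorphic_add (h : IsKahlerCurvature J R) (sq : ∀ v, J (J v) = -v) (a b : E)
    (h1 : R a (J a) a (J b) = 0) (h3 : R b (J b) a (J b) = 0) :
    R (a + b) (J (a + b)) (J (a + b)) (a + b) =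
      R a (J a) (J a) a + R b (J b) (J b) b - 2 * R a b a b - 6 * R a (J b) a (J b) := by
  have js := h.J_swap sq
  have jl := h.J_swap_left sq
  have c1 : ∀ u v, R u (J v) = R v (J u) := by
    intro u v
    ext w z
    rw [h.skew_left, jl, neg_neg]
  have c2 : ∀ u v w z, R u v w (J z) = R u v z (J w) := by
    intro u v w z
    rw [h.skew_right, js, neg_neg]
  have ps := h.pair_symm
  simp only [map_add, h.add, h.add₂, h.add₃, h.add₄, js]
  simp only [c1 b a, fun u v => c2 u v b a]
  -- The quadratic mixed terms are `-2 R(a,Ja,b,Jb) - 4 R(a,Jb,a,Jb)`. Bianchi replaces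
  -- `R(a,Ja,b,Jb)` by `R(a,b,a,b) + R(a,Jb,a,Jb)`, whence the coefficients 2 and 6.
  have hb := h.bianchi a (J a) b (J b)
  have e1 : R (J a) b a (J b) = -R a (J b) a (J b) := by rw [jl]
  have e2 : R b a (J a) (J b) = -R a b a b := by rw [h.J_right, h.skew_left]
  rw [e1, e2] at hb
  rw [h1, h3, ps b (J b) a (J a), ps a (J b) a (J a), h1, ps a (J b) b (J b), h3]
  linarith

theorem apply_self_left (h : IsKahlerCurvature J R) (v : E) : R v v = 0 := by
  ext w z
  have := h.skew_left v v w z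
  simp only [Pi.zero_apply]
  linarith

theorem apply_line (h : IsKahlerCurvature J R) (sq : ∀ v, J (J v) = -v) (x y : ℝ) (a w z : E) :
    R (x • a + y • J a) (J (x • a + y • J a)) w z = (x ^ 2 + y ^ 2) * R a (J a) w z := by
  simp only [map_add, map_smul, sq, h.add, h.smul, h.add₂, h.smul₂, h.neg₂, h.apply_self_left,
    Pi.zero_apply]
  rw [h.skew_left (J a) a]
  ring

/-- The holomorphic sectional curvature only depends on the complex line. -/
theorem holomorphic_line (h : IsKahlerCurvature J R) (sq : ∀ v, J (J v) = -v) (x y : ℝ) (a : E) :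
    R (x • a + y • J a) (J (x • a + y • J a)) (J (x • a + y • J a)) (x • a + y • J a) =
      (x ^ 2 + y ^ 2) ^ 2 * R a (J a) (J a) a := by
  rw [h.apply_line sq, h.pair_symm a (J a) (J _), h.skew_left (J _), h.apply_line sq,
    h.skew_right a (J a) (J a) a]
  ring

/-- The holomorphic sectional curvature of a curvature tensor of Kähler type that satisfies the
identities of a Kähler surface of Calabi type with Killing field `ξ`. -/
theorem holomorphic_eq (h : IsKahlerCurvature J R) {G : E → E → ℝ} {ξ : E}
    (sq : ∀ v, J (J v) = -v)
    (hb1 : ∀ b c d, G b ξ = 0 → G b (J ξ) = 0 → G c ξ = 0 → G c (J ξ) = 0 → G d ξ = 0 →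
      G d (J ξ) = 0 → R b c ξ d = 0)
    (hb2 : ∀ b, G b ξ = 0 → G b (J ξ) = 0 → R ξ (J ξ) ξ b = 0)
    (m k : ℝ)
    (hb3 : ∀ b c, G b ξ = 0 → G b (J ξ) = 0 → G c ξ = 0 → G c (J ξ) = 0 →
      R ξ b ξ c = m * G b c)
    (hb4 : ∀ b c, G b ξ = 0 → G b (J ξ) = 0 → G c ξ = 0 → G c (J ξ) = 0 →
      R (J ξ) b ξ c = k * G (J b) c)
    (hJ : ∀ b, G b ξ = 0 → G b (J ξ) = 0 → G (J b) ξ = 0 ∧ G (J b) (J ξ) = 0)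
    (orth : ∀ b c, G (J b) (J c) = G b c) (hJself : ∀ b, G (J b) b = 0)
    (hne : ∃ b, G b b ≠ 0 ∧ G b ξ = 0 ∧ G b (J ξ) = 0)
    (hneg : ∀ b c, G (-b) c = -G b c)
    (x y : ℝ) (b : E) (h1 : G b ξ = 0) (h2 : G b (J ξ) = 0) :
    R (x • ξ + y • J ξ + b) (J (x • ξ + y • J ξ + b)) (J (x • ξ + y • J ξ + b))
        (x • ξ + y • J ξ + b) =
      (x ^ 2 + y ^ 2) ^ 2 * R ξ (J ξ) (J ξ) ξ + R b (J b) (J b) b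
        - 8 * m * (x ^ 2 + y ^ 2) * G b b := by
  have hJb := hJ b h1 h2
  have hmk : k = -m := by
    obtain ⟨c, hc0, hc1, hc2⟩ := hne
    obtain ⟨hc3, hc4⟩ := hJ c hc1 hc2
    have e := hb4 (J c) c hc3 hc4 hc1 hc2
    rw [h.J_left, hb3 c c hc1 hc2 hc1 hc2, sq, hneg] at e
    have : (k + m) * G c c = 0 := by linarith
    linarith [(mul_eq_zero.1 this).resolve_right hc0]
  have js := h.J_swap sq
  have jl := h.J_swap_left sq
  have hab : ∀ b, G b ξ = 0 → G b (J ξ) = 0 →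
      R (x • ξ + y • J ξ) b (x • ξ + y • J ξ) b = m * (x ^ 2 + y ^ 2) * G b b := by
    intro b h1 h2
    obtain ⟨h3, h4⟩ := hJ b h1 h2
    simp only [h.add, h.smul, h.add₃, h.smul₃]
    have e1 : R (J ξ) b ξ b = 0 := by rw [hb4 b b h1 h2 h1 h2, hJself, mul_zero]
    rw [h.pair_symm ξ b (J ξ) b, e1, js, hb3 b b h1 h2 h1 h2, hb4 b (J b) h1 h2 h3 h4, orth, hmk]
    ring
  have o1 : R (x • ξ + y • J ξ) (J (x • ξ + y • J ξ)) (x • ξ + y • J ξ) (J b) = 0 := by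
    rw [h.apply_line sq]
    simp only [h.add₃, h.smul₃, hb2 _ hJb.1 hJb.2, h.J_right, hb2 b h1 h2]
    ring
  have o3 : R b (J b) (x • ξ + y • J ξ) (J b) = 0 := by
    simp only [h.add₃, h.smul₃, h.J_right, hb1 b (J b) b h1 h2 hJb.1 hJb.2 h1 h2,
      hb1 b (J b) (J b) h1 h2 hJb.1 hJb.2 hJb.1 hJb.2]
    ring
  rw [h.holomorphic_add sq _ _ o1 o3, hab b h1 h2, hab _ hJb.1 hJb.2, orth,
    h.holomorphic_line sq]
  ring

end IsKahlerCurvature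

end LocalGeom

/-! ### The Levi-Civita connection on an open subset of a vector space -/

namespace LocalGeom

variable {E : Type*} [NormedAddCommGroup E] [NormedSpace ℝ E]

/-- `G` is a smooth Riemannian metric on the open set `U`. -/
structure IsMetricOn (G : E → E →L[ℝ] E →L[ℝ] ℝ) (U : Set E) : Prop where
  isOpen : IsOpen U
  smooth : ContDiffOn ℝ ∞ G U
  symm : ∀ y ∈ U, ∀ v w, G y v w = G y w v
  pos : ∀ y ∈ U, ∀ v, v ≠ 0 → 0 < G y v v

/-- The Christoffel symbols as a field of bilinear maps. -/
noncomputable def christoffelL (G : E → E →L[ℝ] E →L[ℝ] ℝ) (y : E) : E →L[ℝ] E →L[ℝ] E :=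
  (ContinuousLinearMap.compL ℝ E (E →L[ℝ] ℝ) E (G y).inverse).comp
    ((1 / 2 : ℝ) • (fderiv ℝ G y + ContinuousLinearMap.flipₗᵢ ℝ E E (E →L[ℝ] ℝ) (fderiv ℝ G y) -
      (ContinuousLinearMap.flipₗᵢ ℝ E E ℝ).toContinuousLinearEquiv.toContinuousLinearMap.comp
        (ContinuousLinearMap.flipₗᵢ ℝ E E (E →L[ℝ] ℝ) (fderiv ℝ G y))))

/-- The covariant derivative of a vector field. -/
noncomputable def covVec (G : E → E →L[ℝ] E →L[ℝ] ℝ) (V : E → E) (y : E) : E →L[ℝ] E :=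
  fderiv ℝ V y + (christoffelL G y).flip (V y)

/-- The covariant derivative of a field of endomorphisms. -/
noncomputable def covEnd (G : E → E →L[ℝ] E →L[ℝ] ℝ) (A : E → E →L[ℝ] E) (y u v : E) : E :=
  fderiv ℝ A y u v + christoffelL G y u (A y v) - A y (christoffelL G y u v)

theorem fderiv_clm_apply_const {F : Type*} [NormedAddCommGroup F] [NormedSpace ℝ F]
    {A : E → E →L[ℝ] F} {y : E} (hA : DifferentiableAt ℝ A y) (u v : E) :
    fderiv ℝ (fun z => A z v) y u = fderiv ℝ A y u v := by
  rw [fderiv_clm_apply hA (differentiableAt_const v)]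
  simp

theorem fderiv_clm_apply_apply {F : Type*} [NormedAddCommGroup F] [NormedSpace ℝ F]
    {A : E → E →L[ℝ] F} {V : E → E} {y : E} (hA : DifferentiableAt ℝ A y)
    (hV : DifferentiableAt ℝ V y) (u : E) :
    fderiv ℝ (fun z => A z (V z)) y u = fderiv ℝ A y u (V y) + A y (fderiv ℝ V y u) := by
  rw [fderiv_clm_apply hA hV]
  simp [add_comm]

theorem second_fderiv_symm {F : Type*} [NormedAddCommGroup F] [NormedSpace ℝ F] {f : E → F} {y : E}
    (hf : ContDiffAt ℝ ∞ f y) (u v : E) :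
    fderiv ℝ (fderiv ℝ f) y u v = fderiv ℝ (fderiv ℝ f) y v u :=
  hf.isSymmSndFDerivAt (by simpa using (mod_cast le_top : ((2 : ℕ∞) : WithTop ℕ∞) ≤ ∞)) u v

theorem differentiableAt_fderiv {F : Type*} [NormedAddCommGroup F] [NormedSpace ℝ F] {f : E → F}
    {y : E} (hf : ContDiffAt ℝ ∞ f y) : DifferentiableAt ℝ (fderiv ℝ f) y :=
  ContDiffAt.differentiableAt (n := ∞) (hf.fderiv_right (by simp)) (by simp)

namespace IsMetricOn

variable {G : E → E →L[ℝ] E →L[ℝ] ℝ} {U : Set E}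

theorem contDiffAt (h : IsMetricOn G U) {y : E} (hy : y ∈ U) : ContDiffAt ℝ ∞ G y :=
  h.smooth.contDiffAt (h.isOpen.mem_nhds hy)

theorem differentiableAt (h : IsMetricOn G U) {y : E} (hy : y ∈ U) : DifferentiableAt ℝ G y :=
  (h.contDiffAt hy).differentiableAt (by simp)

theorem eq_of_inner_eq (h : IsMetricOn G U) {y : E} (hy : y ∈ U) {v v' : E}
    (hv : ∀ w, G y v w = G y v' w) : v = v' := by
  by_contra hne
  have := h.pos y hy (v - v') (sub_ne_zero.2 hne)
  simp [hv] at this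

theorem fderiv_metric (h : IsMetricOn G U) {y : E} (hy : y ∈ U) (u v w : E) :
    fderiv ℝ (fun z => G z v w) y u = fderiv ℝ G y u v w := by
  have h1 : DifferentiableAt ℝ (fun z => G z v) y :=
    (h.differentiableAt hy).clm_apply (differentiableAt_const v)
  rw [fderiv_clm_apply_const h1, fderiv_clm_apply_const (h.differentiableAt hy)]

theorem fderiv_symm (h : IsMetricOn G U) {y : E} (hy : y ∈ U) (u v w : E) :
    fderiv ℝ G y u v w = fderiv ℝ G y u w v := by
  rw [← h.fderiv_metric hy, ← h.fderiv_metric hy]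
  congr 1
  apply Filter.EventuallyEq.fderiv_eq
  filter_upwards [h.isOpen.mem_nhds hy] with z hz using h.symm z hz v w

/-- Passes from the pointwise Christoffel symbol to a field of continuous bilinear maps, which can
be differentiated as a whole. -/
theorem christoffel_eq (h : IsMetricOn G U) {y : E} (hy : y ∈ U) (u v : E) :
    christoffel G y u v = christoffelL G y u v := by
  have : fderiv ℝ (fun z => G z u v) y = ((fderiv ℝ G y).flip u).flip v := by
    ext w
    rw [h.fderiv_metric hy]; rfl
  simp only [christoffel, this]
  rfl

variable [FiniteDimensional ℝ E]

/-- Definiteness gives injectivity, and equality of dimensions the rest. Without this, `inverse`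
would take its default value 0 and the Christoffel symbols would mean nothing. -/
theorem isInvertible (h : IsMetricOn G U) {y : E} (hy : y ∈ U) : (G y).IsInvertible := by
  have hinj : Function.Injective (G y : E →ₗ[ℝ] (E →L[ℝ] ℝ)) := by
    intro v v' hv
    exact h.eq_of_inner_eq hy fun w => DFunLike.congr_fun hv w
  have hd : Module.finrank ℝ E = Module.finrank ℝ (E →L[ℝ] ℝ) := by
    rw [← LinearEquiv.finrank_eq (LinearMap.toContinuousLinearMap : (E →ₗ[ℝ] ℝ) ≃ₗ[ℝ] E →L[ℝ] ℝ)]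
    exact (Subspace.dual_finrank_eq (K := ℝ) (V := E)).symm
  refine ⟨(LinearEquiv.ofInjectiveOfFinrankEq (G y : E →ₗ[ℝ] (E →L[ℝ] ℝ)) hinj hd).toContinuousLinearEquiv, ?_⟩
  ext v w
  rfl

theorem inner_christoffelL (h : IsMetricOn G U) {y : E} (hy : y ∈ U) (u v w : E) :
    G y (christoffelL G y u v) w =
      (fderiv ℝ G y u v w + fderiv ℝ G y v u w - fderiv ℝ G y w u v) / 2 := by
  have : christoffelL G y u v = (G y).inverse ((1 / 2 : ℝ) •
      (fderiv ℝ G y u v + fderiv ℝ G y v u - ((fderiv ℝ G y).flip u).flip v)) := rfl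
  rw [this, (h.isInvertible hy).self_apply_inverse]
  simp
  ring

theorem christoffelL_symm (h : IsMetricOn G U) {y : E} (hy : y ∈ U) (u v : E) :
    christoffelL G y u v = christoffelL G y v u := by
  apply h.eq_of_inner_eq hy
  intro w
  rw [h.inner_christoffelL hy, h.inner_christoffelL hy, h.fderiv_symm hy w u v]
  ring

theorem metric_compat (h : IsMetricOn G U) {y : E} (hy : y ∈ U) (u v w : E) :
    fderiv ℝ G y u v w = G y (christoffelL G y u v) w + G y v (christoffelL G y u w) := by
  rw [h.symm y hy v, h.inner_christoffelL hy, h.inner_christoffelL hy, h.fderiv_symm hy v u w,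
    h.fderiv_symm hy w u v, h.fderiv_symm hy u w v]
  ring

theorem contDiffAt_christoffelL (h : IsMetricOn G U) {y : E} (hy : y ∈ U) :
    ContDiffAt ℝ ∞ (christoffelL G) y := by
  have hG := h.contDiffAt hy
  have h1 : ContDiffAt ℝ ∞ (fun z => (G z).inverse) y :=
    (h.isInvertible hy).contDiffAt_map_inverse.comp y hG
  have h2 : ContDiffAt ℝ ∞ (fderiv ℝ G) y := hG.fderiv_right (by simp)
  have h3 : ContDiffAt ℝ ∞ (fun z => ContinuousLinearMap.flipₗᵢ ℝ E E (E →L[ℝ] ℝ) (fderiv ℝ G z)) y :=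
    (ContinuousLinearMap.flipₗᵢ ℝ E E (E →L[ℝ] ℝ)).contDiff.contDiffAt.comp y h2
  unfold christoffelL
  refine ContDiffAt.clm_comp ?_ ?_
  · exact (ContinuousLinearMap.compL ℝ E (E →L[ℝ] ℝ) E).contDiff.contDiffAt.comp y h1
  · exact ((h2.add h3).sub (contDiffAt_const.clm_comp h3)).const_smul _

theorem differentiableAt_christoffelL (h : IsMetricOn G U) {y : E} (hy : y ∈ U) :
    DifferentiableAt ℝ (christoffelL G) y :=
  (h.contDiffAt_christoffelL hy).differentiableAt (by simp)

theorem curvature_eq (h : IsMetricOn G U) {y : E} (hy : y ∈ U) (u v w : E) :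
    curvature G y u v w = fderiv ℝ (christoffelL G) y u v w - fderiv ℝ (christoffelL G) y v u w +
      christoffelL G y u (christoffelL G y v w) - christoffelL G y v (christoffelL G y u w) := by
  have hd := h.differentiableAt_christoffelL hy
  have key : ∀ u v, fderiv ℝ (fun z => christoffel G z v w) y u =
      fderiv ℝ (christoffelL G) y u v w := by
    intro u v
    have e : (fun z => christoffel G z v w) =ᶠ[nhds y] fun z => christoffelL G z v w := by
      filter_upwards [h.isOpen.mem_nhds hy] with z hz using h.christoffel_eq hz v w
    rw [e.fderiv_eq, fderiv_clm_apply_const (hd.clm_apply (differentiableAt_const v)),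
      fderiv_clm_apply_const hd]
  simp only [curvature, key, h.christoffel_eq hy]

theorem fderiv_christoffelL_symm (h : IsMetricOn G U) {y : E} (hy : y ∈ U) (u v w : E) :
    fderiv ℝ (christoffelL G) y u v w = fderiv ℝ (christoffelL G) y u w v := by
  have hd := h.differentiableAt_christoffelL hy
  have e : (fun z => christoffelL G z v w) =ᶠ[nhds y] fun z => christoffelL G z w v := by
    filter_upwards [h.isOpen.mem_nhds hy] with z hz using h.christoffelL_symm hz v w
  have := congrArg (fun L : E →L[ℝ] E => L u) e.fderiv_eq
  rwa [fderiv_clm_apply_const (hd.clm_apply (differentiableAt_const v)),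
    fderiv_clm_apply_const hd, fderiv_clm_apply_const (hd.clm_apply (differentiableAt_const w)),
    fderiv_clm_apply_const hd] at this

theorem curvature_bianchi (h : IsMetricOn G U) {y : E} (hy : y ∈ U) (u v w : E) :
    curvature G y u v w + curvature G y v w u + curvature G y w u v = 0 := by
  simp only [h.curvature_eq hy]
  rw [h.fderiv_christoffelL_symm hy u v w, h.fderiv_christoffelL_symm hy v w u,
    h.fderiv_christoffelL_symm hy w u v, h.christoffelL_symm hy v w, h.christoffelL_symm hy w u,
    h.christoffelL_symm hy u v]
  abel

theorem curvature_skew_left (h : IsMetricOn G U) {y : E} (hy : y ∈ U) (u v w : E) :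
    curvature G y u v w = -curvature G y v u w := by
  simp only [h.curvature_eq hy]
  abel

/-- The second derivative of the metric in terms of the connection. -/
theorem second_fderiv_metric (h : IsMetricOn G U) {y : E} (hy : y ∈ U) (u v w z : E) :
    fderiv ℝ (fderiv ℝ G) y u v w z =
      fderiv ℝ G y u (christoffelL G y v w) z + G y (fderiv ℝ (christoffelL G) y u v w) z +
      (fderiv ℝ G y u w (christoffelL G y v z) + G y w (fderiv ℝ (christoffelL G) y u v z)) := by
  have hd := h.differentiableAt_christoffelL hy
  have hG := h.differentiableAt hy
  have hG2 := differentiableAt_fderiv (h.contDiffAt hy)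
  have e : (fun x => fderiv ℝ G x v w z) =ᶠ[nhds y]
      fun x => G x (christoffelL G x v w) z + G x w (christoffelL G x v z) := by
    filter_upwards [h.isOpen.mem_nhds hy] with x hx using h.metric_compat hx v w z
  have d2 : ∀ w, DifferentiableAt ℝ (fun x => christoffelL G x v w) y := fun w =>
    (hd.clm_apply (differentiableAt_const v)).clm_apply (differentiableAt_const w)
  have f2 : ∀ w, fderiv ℝ (fun x => christoffelL G x v w) y u = fderiv ℝ (christoffelL G) y u v w := by
    intro w
    rw [fderiv_clm_apply_const (hd.clm_apply (differentiableAt_const v)), fderiv_clm_apply_const hd]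
  have := congrArg (fun L : E →L[ℝ] ℝ => L u) e.fderiv_eq
  rw [fderiv_clm_apply_const ((hG2.clm_apply (differentiableAt_const v)).clm_apply
      (differentiableAt_const w)), fderiv_clm_apply_const (hG2.clm_apply (differentiableAt_const v)),
      fderiv_clm_apply_const hG2,
      fderiv_fun_add ((hG.clm_apply (d2 w)).clm_apply (differentiableAt_const z))
        ((hG.clm_apply (differentiableAt_const w)).clm_apply (d2 z)),
      add_apply, fderiv_clm_apply_const (hG.clm_apply (d2 w)), fderiv_clm_apply_apply hG (d2 w),
      fderiv_clm_apply_apply (hG.clm_apply (differentiableAt_const w)) (d2 z),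
      fderiv_clm_apply_const hG, f2, f2] at this
  simpa using this

/-- The second derivatives of `G` commute; expanding both orders by metric compatibility leaves
`G(R(u,v)w, z) + G(w, R(u,v)z) = 0`. -/
theorem curvature_skew_right (h : IsMetricOn G U) {y : E} (hy : y ∈ U) (u v w z : E) :
    G y (curvature G y u v w) z = -G y (curvature G y u v z) w := by
  have h1 : fderiv ℝ (fderiv ℝ G) y u v w z = fderiv ℝ (fderiv ℝ G) y v u w z := by
    rw [second_fderiv_symm (h.contDiffAt hy)]
  rw [h.second_fderiv_metric hy, h.second_fderiv_metric hy] at h1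
  simp only [h.metric_compat hy] at h1
  simp only [h.curvature_eq hy, map_add, map_sub, add_apply, sub_apply]
  rw [h.symm y hy (fderiv ℝ (christoffelL G) y u v z) w,
    h.symm y hy (fderiv ℝ (christoffelL G) y v u z) w,
    h.symm y hy (christoffelL G y u (christoffelL G y v z)) w,
    h.symm y hy (christoffelL G y v (christoffelL G y u z)) w]
  linarith

/-- If `∇_v V = W v` near `y` for a field of endomorphisms `W`, then
`R(u, v) V = (∇_u W) v - (∇_v W) u`. -/
theorem curvature_apply_vec (h : IsMetricOn G U) {y : E} (hy : y ∈ U) {V : E → E}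
    (hV : ContDiffAt ℝ ∞ V y) {W : E → E →L[ℝ] E} (hW : DifferentiableAt ℝ W y)
    (hVW : ∀ᶠ z in nhds y, covVec G V z = W z) (u v : E) :
    curvature G y u v (V y) = covEnd G W y u v - covEnd G W y v u := by
  have hd := h.differentiableAt_christoffelL hy
  have hV1 : DifferentiableAt ℝ V y := hV.differentiableAt (by simp)
  have hV2 := differentiableAt_fderiv hV
  have key : ∀ u v, fderiv ℝ W y u v = fderiv ℝ (fderiv ℝ V) y u v +
      fderiv ℝ (christoffelL G) y u v (V y) + christoffelL G y v (fderiv ℝ V y u) := by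
    intro u v
    have e : (fun z => W z v) =ᶠ[nhds y] fun z => fderiv ℝ V z v + christoffelL G z v (V z) := by
      filter_upwards [hVW] with z hz
      rw [← hz]; rfl
    rw [← fderiv_clm_apply_const hW, e.fderiv_eq,
      fderiv_fun_add (hV2.clm_apply (differentiableAt_const v))
        ((hd.clm_apply (differentiableAt_const v)).clm_apply hV1), add_apply,
      fderiv_clm_apply_const hV2, fderiv_clm_apply_apply (hd.clm_apply (differentiableAt_const v)) hV1,
      fderiv_clm_apply_const hd]
    abel
  have hy' : ∀ v, W y v = fderiv ℝ V y v + christoffelL G y v (V y) := by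
    intro v
    rw [← hVW.self_of_nhds]; rfl
  simp only [covEnd, key, hy', h.curvature_eq hy, map_add]
  rw [second_fderiv_symm hV v u, h.christoffelL_symm hy v u]
  abel

/-- The curvature commutes with a parallel field of endomorphisms. -/
theorem curvature_apply_parallel (h : IsMetricOn G U) {y : E} (hy : y ∈ U) {J : E → E →L[ℝ] E}
    (hJ : ContDiffAt ℝ ∞ J y) (hp : ∀ᶠ z in nhds y, ∀ u v, covEnd G J z u v = 0) (u v w : E) :
    curvature G y u v (J y w) = J y (curvature G y u v w) := by
  have hd := h.differentiableAt_christoffelL hy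
  have hJ1 : DifferentiableAt ℝ J y := hJ.differentiableAt (by simp)
  have hJ2 := differentiableAt_fderiv hJ
  have h1 : ∀ z, (∀ u v, covEnd G J z u v = 0) → ∀ u v, fderiv ℝ J z u v =
      J z (christoffelL G z u v) - christoffelL G z u (J z v) := by
    intro z hz u v
    have := hz u v
    rw [covEnd] at this
    rw [← sub_eq_zero]
    rw [← this]; abel
  have key : ∀ u v, fderiv ℝ (fderiv ℝ J) y u v w =
      fderiv ℝ J y u (christoffelL G y v w) + J y (fderiv ℝ (christoffelL G) y u v w) -
      (fderiv ℝ (christoffelL G) y u v (J y w) + christoffelL G y v (fderiv ℝ J y u w)) := by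
    intro u v
    have e : (fun z => fderiv ℝ J z v w) =ᶠ[nhds y]
        fun z => J z (christoffelL G z v w) - christoffelL G z v (J z w) := by
      filter_upwards [hp] with z hz using h1 z hz v w
    have := congrArg (fun L : E →L[ℝ] E => L u) e.fderiv_eq
    have d1 := hd.clm_apply (differentiableAt_const v)
    have d2 := d1.clm_apply (differentiableAt_const w)
    have d3 := hJ1.clm_apply (differentiableAt_const w)
    rw [fderiv_clm_apply_const (hJ2.clm_apply (differentiableAt_const v)),
      fderiv_clm_apply_const hJ2, fderiv_fun_sub (hJ1.clm_apply d2) (d1.clm_apply d3), sub_apply,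
      fderiv_clm_apply_apply hJ1 d2, fderiv_clm_apply_apply d1 d3, fderiv_clm_apply_const d1,
      fderiv_clm_apply_const hd, fderiv_clm_apply_const hJ1] at this
    exact this
  have h2 : fderiv ℝ (fderiv ℝ J) y u v w = fderiv ℝ (fderiv ℝ J) y v u w := by
    rw [second_fderiv_symm hJ]
  rw [key, key] at h2
  simp only [h1 y hp.self_of_nhds, map_sub] at h2
  simp only [h.curvature_eq hy, map_add, map_sub]
  rw [← sub_eq_zero] at h2 ⊢
  rw [← neg_eq_zero, ← h2]
  abel

end IsMetricOn

end LocalGeom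

/-! ### Kähler structures on an open subset of a vector space -/

namespace LocalGeom

variable {E : Type*} [NormedAddCommGroup E] [NormedSpace ℝ E]

/-- `(G, A)` is an almost Hermitian structure on the open set `U` for which the Nijenhuis tensor of
`A` vanishes and the Kähler form of `f G` is closed. -/
structure IsConfKahlerOn (G : E → E →L[ℝ] E →L[ℝ] ℝ) (A : E → E →L[ℝ] E) (f : E → ℝ) (U : Set E) :
    Prop extends IsMetricOn G U where
  smooth_end : ContDiffOn ℝ ∞ A U
  sq : ∀ y ∈ U, ∀ v, A y (A y v) = -v
  orth : ∀ y ∈ U, ∀ v w, G y (A y v) (A y w) = G y v w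
  smooth_factor : ContDiffOn ℝ ∞ f U
  pos_factor : ∀ y ∈ U, 0 < f y
  integrable : ∀ y ∈ U, ∀ u v, nijenhuis A y u v = 0
  closed : ∀ y ∈ U, ∀ u v w, extDerivTwoForm (fun z a b => f z * G z (A z a) b) y u v w = 0

/-- Half the logarithmic derivative of `f`. -/
noncomputable def halfLogDeriv (f : E → ℝ) (y : E) : E →L[ℝ] ℝ := (1 / (2 * f y)) • fderiv ℝ f y

namespace IsConfKahlerOn

variable {G : E → E →L[ℝ] E →L[ℝ] ℝ} {A : E → E →L[ℝ] E} {f : E → ℝ} {U : Set E}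

theorem contDiffAt_end (h : IsConfKahlerOn G A f U) {y : E} (hy : y ∈ U) : ContDiffAt ℝ ∞ A y :=
  h.smooth_end.contDiffAt (h.isOpen.mem_nhds hy)

theorem differentiableAt_end (h : IsConfKahlerOn G A f U) {y : E} (hy : y ∈ U) :
    DifferentiableAt ℝ A y :=
  (h.contDiffAt_end hy).differentiableAt (by simp)

theorem contDiffAt_factor (h : IsConfKahlerOn G A f U) {y : E} (hy : y ∈ U) :
    ContDiffAt ℝ ∞ f y :=
  h.smooth_factor.contDiffAt (h.isOpen.mem_nhds hy)

theorem skew (h : IsConfKahlerOn G A f U) {y : E} (hy : y ∈ U) (v w : E) :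
    G y (A y v) w = -G y v (A y w) := by
  rw [← h.orth y hy v (A y w), h.sq y hy]; simp

variable [FiniteDimensional ℝ E]

/-- Splits the derivative of the Kähler form into its covariant part and Christoffel terms; the
latter cancel in the skew-symmetry of `∇A` and in the cyclic sum for the exterior derivative. -/
theorem fderiv_form (h : IsConfKahlerOn G A f U) {y : E} (hy : y ∈ U) (u v w : E) :
    fderiv ℝ (fun z => G z (A z v) w) y u = G y (covEnd G A y u v) w -
      G y (christoffelL G y u v) (A y w) + G y (A y v) (christoffelL G y u w) := by
  have hG := h.differentiableAt hy
  have hA := h.differentiableAt_end hy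
  have hAv := hA.clm_apply (differentiableAt_const v)
  rw [fderiv_clm_apply_const (hG.clm_apply hAv), fderiv_clm_apply_apply hG hAv,
    fderiv_clm_apply_const hA, add_apply, h.metric_compat hy]
  simp only [covEnd, map_add, map_sub, add_apply, sub_apply]
  rw [h.skew hy (christoffelL G y u v)]
  ring

theorem covEnd_skew (h : IsConfKahlerOn G A f U) {y : E} (hy : y ∈ U) (u v w : E) :
    G y (covEnd G A y u v) w = -G y (covEnd G A y u w) v := by
  have e : (fun z => G z (A z v) w) =ᶠ[nhds y] fun z => -G z (A z w) v := by
    filter_upwards [h.isOpen.mem_nhds hy] with z hz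
    rw [h.skew hz, h.symm z hz]
  have := congrArg (fun L : E →L[ℝ] ℝ => L u) e.fderiv_eq
  rw [fderiv_fun_neg, neg_apply, h.fderiv_form hy, h.fderiv_form hy,
    h.symm y hy _ (A y w), h.symm y hy _ (A y v)] at this
  linarith

/-- The covariant derivative of the complex structure is determined by the Lee form. -/
theorem covEnd_eq (h : IsConfKahlerOn G A f U) {y : E} (hy : y ∈ U) (u v w : E) :
    G y (covEnd G A y u v) w = leeTensor (G y) (A y) (halfLogDeriv f y) u v w := by
  have hG := h.differentiableAt hy
  have hA := h.differentiableAt_end hy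
  have hf0 := (h.pos_factor y hy).ne'
  refine eq_leeTensor (h.symm y hy) (h.sq y hy) (h.orth y hy)
    (fun u v w => G y (covEnd G A y u v) w) ?_ (h.covEnd_skew hy) ?_ ?_ u v w
  · intro u v w
    simp only [covEnd, map_neg, map_sub, map_add, neg_apply, add_apply, sub_apply]
    ring
  · intro u v w
    have hc := h.closed y hy u v w
    have key : ∀ u v w, fderiv ℝ (fun z => f z * G z (A z v) w) y u =
        fderiv ℝ f y u * G y (A y v) w + f y * (G y (covEnd G A y u v) w -
          G y (christoffelL G y u v) (A y w) + G y (A y v) (christoffelL G y u w)) := by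
      intro u v w
      rw [fderiv_fun_mul ((h.contDiffAt_factor hy).differentiableAt (by simp))
        ((hG.clm_apply (hA.clm_apply (differentiableAt_const v))).clm_apply
          (differentiableAt_const w)), add_apply, smul_apply, smul_apply, h.fderiv_form hy]
      simp only [smul_eq_mul]
      ring
    simp only [extDerivTwoForm, key] at hc
    simp only [halfLogDeriv, smul_apply, smul_eq_mul]
    rw [h.christoffelL_symm hy v u, h.christoffelL_symm hy w u, h.christoffelL_symm hy w v,
      h.symm y hy (A y v), h.symm y hy (A y w), h.symm y hy (A y u)] at hc
    rw [h.symm y hy (A y v), h.symm y hy (A y w), h.symm y hy (A y u)]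
    field_simp
    rw [h.symm y hy (A y v) (christoffelL G y u w), h.symm y hy (A y w) (christoffelL G y u v),
      h.symm y hy (A y u) (christoffelL G y v w)] at hc
    linarith
  -- As the connection is torsion-free, the Nijenhuis tensor can be written with `∇A` in place of
  -- partial derivatives.
  · intro u v w
    have hN := h.integrable y hy u v
    simp only [nijenhuis, VectorField.lieBracket, fderiv_clm_apply_const hA, fderiv_fun_const,
      Pi.zero_apply, zero_apply, sub_zero, zero_sub, map_neg, sub_neg_eq_add] at hN
    have e : covEnd G A y (A y u) v - covEnd G A y (A y v) u -
        A y (covEnd G A y u v) + A y (covEnd G A y v u) = 0 := by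
      rw [← hN]
      simp only [covEnd, map_add, map_sub, h.sq y hy]
      rw [h.christoffelL_symm hy v u, h.christoffelL_symm hy v (A y u),
        h.christoffelL_symm hy u (A y v), h.christoffelL_symm hy (A y v) (A y u)]
      abel
    have e' := congrArg (fun x => G y x w) e
    simp only [map_add, map_sub, add_apply, sub_apply, h.skew hy, map_zero, zero_apply] at e'
    linarith

theorem covEnd_eq_zero {f : E → ℝ} (h : IsConfKahlerOn G A f U) (hf : f = fun _ => 1) {y : E}
    (hy : y ∈ U) (u v : E) : covEnd G A y u v = 0 := by
  apply h.eq_of_inner_eq hy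
  intro w
  rw [h.covEnd_eq hy, hf]
  simp [leeTensor, halfLogDeriv]

/-- The curvature tensor of a Kähler metric. -/
theorem isKahlerCurvature (h : IsConfKahlerOn G A (fun _ => 1) U) {y : E} (hy : y ∈ U) :
    IsKahlerCurvature (A y : E →ₗ[ℝ] E) (fun u v w z => G y (curvature G y u v w) z) where
  add u u' v w z := by
    simp only [h.curvature_eq hy, map_add, map_sub, add_apply, sub_apply]; ring
  smul c u v w z := by
    simp only [h.curvature_eq hy, map_add, map_sub, map_smul, add_apply, sub_apply, smul_apply,
      smul_eq_mul]
    ring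
  skew_left u v w z := by
    rw [h.curvature_skew_left hy]; simp
  skew_right u v w z := h.curvature_skew_right hy u v w z
  bianchi u v w z := by
    have := congrArg (fun x => G y x z) (h.curvature_bianchi hy u v w)
    simpa using this
  J_right u v w z := by
    change G y (curvature G y u v (A y w)) (A y z) = _
    rw [h.curvature_apply_parallel hy (h.contDiffAt_end hy), h.orth y hy]
    filter_upwards [h.isOpen.mem_nhds hy] with z hz u v
    exact h.covEnd_eq_zero rfl hz u v

end IsConfKahlerOn

/-! ### Calabi-type data on an open set: the Killing field and the Lee form -/

/-- A Kähler structure `(G, J)` of Calabi type on the open set `U`. -/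
structure IsCalabiOn (G : E → E →L[ℝ] E →L[ℝ] ℝ) (J I : E → E →L[ℝ] E) (V : E → E) (f h : E → ℝ)
    (U : Set E) : Prop where
  kahler : IsConfKahlerOn G J (fun _ => 1) U
  conf : IsConfKahlerOn G I f U
  smooth_vec : ContDiffOn ℝ ∞ V U
  ne_zero : ∀ y ∈ U, V y ≠ 0
  killing : ∀ y ∈ U, ∀ u v, lieDerivMetric G V y u v = 0
  smooth_ham : ContDiffOn ℝ ∞ h U
  hamiltonian : ∀ y ∈ U, ∀ v, G y (J y (V y)) v = -fderiv ℝ h y v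
  I_vec : ∀ y ∈ U, I y (V y) = J y (V y)
  I_J_vec : ∀ y ∈ U, I y (J y (V y)) = -V y
  I_perp : ∀ y ∈ U, ∀ b, G y b (V y) = 0 → G y b (J y (V y)) = 0 → I y b = -J y b

/-- If `dF = c dh` then `dc` is a multiple of `dh`. -/
theorem fderiv_factor_mul {F c h : E → ℝ} {y : E} (hF : ContDiffAt ℝ ∞ F y)
    (hh : ContDiffAt ℝ ∞ h y) (hc : DifferentiableAt ℝ c y)
    (e : ∀ᶠ z in nhds y, fderiv ℝ F z = c z • fderiv ℝ h z) (u v : E) :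
    fderiv ℝ c y u * fderiv ℝ h y v = fderiv ℝ c y v * fderiv ℝ h y u := by
  have key : ∀ u v, fderiv ℝ (fderiv ℝ F) y u v =
      c y * fderiv ℝ (fderiv ℝ h) y u v + fderiv ℝ c y u * fderiv ℝ h y v := by
    intro u v
    rw [Filter.EventuallyEq.fderiv_eq e, fderiv_fun_smul hc (differentiableAt_fderiv hh)]
    simp
  have h1 := second_fderiv_symm hF u v
  rw [key, key, second_fderiv_symm hh u v] at h1
  linarith

namespace IsCalabiOn

variable {G : E → E →L[ℝ] E →L[ℝ] ℝ} {J I : E → E →L[ℝ] E} {V : E → E} {f h : E → ℝ} {U : Set E}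

theorem contDiffAt_vec (H : IsCalabiOn G J I V f h U) {y : E} (hy : y ∈ U) : ContDiffAt ℝ ∞ V y :=
  H.smooth_vec.contDiffAt (H.kahler.isOpen.mem_nhds hy)

theorem contDiffAt_ham (H : IsCalabiOn G J I V f h U) {y : E} (hy : y ∈ U) : ContDiffAt ℝ ∞ h y :=
  H.smooth_ham.contDiffAt (H.kahler.isOpen.mem_nhds hy)

theorem differentiableAt_vec (H : IsCalabiOn G J I V f h U) {y : E} (hy : y ∈ U) :
    DifferentiableAt ℝ V y :=
  (H.contDiffAt_vec hy).differentiableAt (by simp)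

theorem norm_pos (H : IsCalabiOn G J I V f h U) {y : E} (hy : y ∈ U) : 0 < G y (V y) (V y) :=
  H.kahler.pos y hy _ (H.ne_zero y hy)

/-- Product rule for the covariant derivative of `A V`. -/
theorem fderiv_end_vec (H : IsCalabiOn G J I V f h U) {y : E} (hy : y ∈ U) {A : E → E →L[ℝ] E}
    (hA : DifferentiableAt ℝ A y) (u : E) :
    fderiv ℝ (fun z => A z (V z)) y u = covEnd G A y u (V y) + A y (covVec G V y u) -
      christoffelL G y u (A y (V y)) := by
  rw [fderiv_clm_apply_apply hA (H.differentiableAt_vec hy)]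
  simp only [covEnd, covVec, add_apply, ContinuousLinearMap.flip_apply, map_add]
  abel

theorem inner_J_vec (H : IsCalabiOn G J I V f h U) {y : E} (hy : y ∈ U) :
    G y (V y) (J y (V y)) = 0 := by
  have h1 := H.kahler.skew hy (V y) (V y)
  rw [H.kahler.symm y hy] at h1
  linarith

theorem perp_J (H : IsCalabiOn G J I V f h U) {y : E} (hy : y ∈ U) {b : E}
    (h1 : G y b (V y) = 0) (h2 : G y b (J y (V y)) = 0) :
    G y (J y b) (V y) = 0 ∧ G y (J y b) (J y (V y)) = 0 :=
  ⟨by rw [H.kahler.skew hy, h2, neg_zero], by rw [H.kahler.orth y hy, h1]⟩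

theorem exists_perp (H : IsCalabiOn G J I V f h U) {y : E} (hy : y ∈ U)
    (hd : 2 < Module.finrank ℝ E) :
    ∃ b, b ≠ 0 ∧ G y b (V y) = 0 ∧ G y b (J y (V y)) = 0 := by
  by_contra! hcon
  have htop : Submodule.span ℝ (Set.range ![V y, J y (V y)]) = ⊤ := by
    rw [eq_top_iff]
    rintro v -
    obtain ⟨x, z, b, rfl, hb1, hb2⟩ := frame_decomposition (H.kahler.symm y hy) (H.norm_pos hy)
      (H.kahler.sq y hy) (H.kahler.orth y hy) v
    have hb : b = 0 := by
      by_contra hne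
      exact hcon b hne hb1 hb2
    rw [hb, add_zero]
    exact Submodule.add_mem _ (Submodule.smul_mem _ _ (Submodule.subset_span ⟨0, rfl⟩))
      (Submodule.smul_mem _ _ (Submodule.subset_span ⟨1, rfl⟩))
  have h1 := finrank_range_le_card (R := ℝ) ![V y, J y (V y)]
  rw [Set.finrank, htop, finrank_top, Fintype.card_fin] at h1
  omega

/-- In real dimension four, the orthogonal complement of `V`, `J V` is a complex line. -/
theorem exists_eq_perp (H : IsCalabiOn G J I V f h U) {y : E} (hy : y ∈ U)
    (hd : Module.finrank ℝ E = 4) {b c : E} (hb : b ≠ 0) (hb1 : G y b (V y) = 0)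
    (hb2 : G y b (J y (V y)) = 0) (hc1 : G y c (V y) = 0) (hc2 : G y c (J y (V y)) = 0) :
    ∃ r s : ℝ, c = r • b + s • J y b := by
  have hs := H.kahler.symm y hy
  have hJb := H.perp_J hy hb1 hb2
  have hq := H.norm_pos hy
  have hb0 := H.kahler.pos y hy b hb
  have h0 := H.inner_J_vec hy
  have h0' : G y (J y (V y)) (V y) = 0 := by rw [hs, h0]
  have k0 : G y b (J y b) = 0 := by
    have h1 := H.kahler.skew hy b b
    rw [hs] at h1
    linarith
  have k0' : G y (J y b) b = 0 := by rw [hs, k0]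
  have ho := H.kahler.orth y hy
  have m1 : G y (V y) b = 0 := by rw [hs, hb1]
  have m2 : G y (J y (V y)) b = 0 := by rw [hs, hb2]
  have m3 : G y (V y) (J y b) = 0 := by rw [hs, hJb.1]
  have m4 : G y (J y (V y)) (J y b) = 0 := by rw [hs, hJb.2]
  have pair : ∀ g : Fin 4 → ℝ, ∀ w, G y (∑ i, g i • ![V y, J y (V y), b, J y b] i) w =
      g 0 * G y (V y) w + g 1 * G y (J y (V y)) w + g 2 * G y b w + g 3 * G y (J y b) w := by
    intro g w
    simp [Fin.sum_univ_four]
  have hli : LinearIndependent ℝ ![V y, J y (V y), b, J y b] := by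
    rw [Fintype.linearIndependent_iff]
    intro g hg
    have e := pair g
    rw [hg] at e
    have e0 := e (V y)
    have e1 := e (J y (V y))
    have e2 := e b
    have e3 := e (J y b)
    simp [h0, h0', hb1, hb2, hJb.1, hJb.2, m1, m2, m3, m4, k0, k0', ho, hq.ne', hb0.ne']
      at e0 e1 e2 e3
    intro i
    fin_cases i <;> assumption
  have htop := hli.span_eq_top_of_card_eq_finrank (by simp [hd])
  have hmem : c ∈ Submodule.span ℝ (Set.range ![V y, J y (V y), b, J y b]) := htop ▸ Submodule.mem_top
  obtain ⟨g, hg⟩ := (Submodule.mem_span_range_iff_exists_fun ℝ).1 hmem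
  have e := pair g
  rw [hg] at e
  have e0 := e (V y)
  have e1 := e (J y (V y))
  simp [h0, h0', hb1, hb2, hJb.1, hJb.2, ho, hq.ne', hc1, hc2] at e0 e1
  refine ⟨g 2, g 3, ?_⟩
  rw [← hg]
  simp [Fin.sum_univ_four, e0, e1]

variable [FiniteDimensional ℝ E]

theorem covVec_skew (H : IsCalabiOn G J I V f h U) {y : E} (hy : y ∈ U) (u v : E) :
    G y (covVec G V y u) v = -G y u (covVec G V y v) := by
  have h1 := H.killing y hy u v
  have hM := H.kahler.toIsMetricOn
  rw [lieDerivMetric, hM.fderiv_metric hy, hM.metric_compat hy, hM.christoffelL_symm hy (V y),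
    hM.christoffelL_symm hy (V y)] at h1
  simp only [covVec, add_apply, ContinuousLinearMap.flip_apply, map_add]
  linarith

/-- Differentiating `G(JV,·) = -dh` with `∇J = 0` shows that `G(J∇_u V, v)` is minus the Hessian of
`h`. Its symmetry, with the skewness of `∇V` and of `J`, is the commutation. -/
theorem covVec_comm (H : IsCalabiOn G J I V f h U) {y : E} (hy : y ∈ U) (u : E) :
    covVec G V y (J y u) = J y (covVec G V y u) := by
  have hM := H.kahler.toIsMetricOn
  have hJ := H.kahler.differentiableAt_end hy
  have hV := H.differentiableAt_vec hy
  have hJV := hJ.clm_apply hV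
  have key : ∀ u v, G y (J y (covVec G V y u)) v + G y (J y (V y)) (christoffelL G y u v) =
      -fderiv ℝ (fderiv ℝ h) y u v := by
    intro u v
    have e : (fun z => G z (J z (V z)) v) =ᶠ[nhds y] fun z => -fderiv ℝ h z v := by
      filter_upwards [hM.isOpen.mem_nhds hy] with z hz using H.hamiltonian z hz v
    have := congrArg (fun L : E →L[ℝ] ℝ => L u) e.fderiv_eq
    rw [fderiv_fun_neg, neg_apply,
      fderiv_clm_apply_const (differentiableAt_fderiv (H.contDiffAt_ham hy)),
      fderiv_clm_apply_const ((hM.differentiableAt hy).clm_apply hJV),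
      fderiv_clm_apply_apply (hM.differentiableAt hy) hJV, add_apply, hM.metric_compat hy,
      H.fderiv_end_vec hy hJ, H.kahler.covEnd_eq_zero rfl hy] at this
    rw [← this]
    simp only [zero_add, map_sub, sub_apply]
    ring
  apply hM.eq_of_inner_eq hy
  intro v
  have h1 := key u v
  have h2 := key v u
  rw [second_fderiv_symm (H.contDiffAt_ham hy) v u, hM.christoffelL_symm hy v u] at h2
  have h3 := H.covVec_skew hy (J y u) v
  rw [hM.symm y hy (J y u), ← neg_eq_iff_eq_neg] at h3
  have h4 := H.kahler.skew hy (covVec G V y v) u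
  linarith

/-- The derivative of `IV = JV`: since `∇J = 0`, it reads `(∇_u I)V = J∇_u V - I∇_u V`. -/
theorem lee_identity (H : IsCalabiOn G J I V f h U) {y : E} (hy : y ∈ U) (u w : E) :
    G y (J y (covVec G V y u) - I y (covVec G V y u)) w =
      leeTensor (G y) (I y) (halfLogDeriv f y) u (V y) w := by
  have hM := H.kahler.toIsMetricOn
  rw [← H.conf.covEnd_eq hy]
  have e : (fun z => I z (V z)) =ᶠ[nhds y] fun z => J z (V z) := by
    filter_upwards [hM.isOpen.mem_nhds hy] with z hz using H.I_vec z hz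
  have := congrArg (fun L : E →L[ℝ] E => L u) e.fderiv_eq
  rw [H.fderiv_end_vec hy (H.kahler.differentiableAt_end hy),
    H.fderiv_end_vec hy (H.conf.differentiableAt_end hy), H.kahler.covEnd_eq_zero rfl hy,
    H.I_vec y hy] at this
  have e2 : covEnd G I y u (V y) = J y (covVec G V y u) - I y (covVec G V y u) := by
    rw [eq_sub_iff_add_eq, ← sub_left_inj, this, zero_add]
  rw [e2]

end IsCalabiOn

end LocalGeom

/-! ### Kähler surfaces of Calabi type: the curvature -/

namespace LocalGeom

variable {E : Type*} [NormedAddCommGroup E] [NormedSpace ℝ E]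

/-- The ratio of `∇_V V` and `J V`. -/
noncomputable def vecCoeff (G : E → E →L[ℝ] E →L[ℝ] ℝ) (J : E → E →L[ℝ] E) (V : E → E) (y : E) : ℝ :=
  G y (covVec G V y (V y)) (J y (V y)) / G y (V y) (V y)

/-- The ratio of the Lee form and `G(J V, ·)`. -/
noncomputable def leeCoeff (G : E → E →L[ℝ] E →L[ℝ] ℝ) (J : E → E →L[ℝ] E) (V : E → E) (f : E → ℝ)
    (y : E) : ℝ :=
  halfLogDeriv f y (J y (V y)) / G y (V y) (V y)

theorem covEnd_combination {G : E → E →L[ℝ] E →L[ℝ] ℝ} {J I : E → E →L[ℝ] E} {α β : E → ℝ} {y : E}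
    (hα : DifferentiableAt ℝ α y) (hβ : DifferentiableAt ℝ β y) (hJ : DifferentiableAt ℝ J y)
    (hI : DifferentiableAt ℝ I y) (u v : E) :
    covEnd G (fun z => α z • J z + β z • I z) y u v =
      fderiv ℝ α y u • J y v + α y • covEnd G J y u v +
      (fderiv ℝ β y u • I y v + β y • covEnd G I y u v) := by
  have h1 : DifferentiableAt ℝ (fun z => α z • J z) y := hα.smul hJ
  have h2 : DifferentiableAt ℝ (fun z => β z • I z) y := hβ.smul hI
  simp only [covEnd]
  rw [fderiv_fun_add h1 h2, fderiv_fun_smul hα hJ, fderiv_fun_smul hβ hI]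
  simp only [add_apply, smul_apply, ContinuousLinearMap.smulRight_apply, map_add, map_smul]
  module

namespace IsCalabiOn

variable {G : E → E →L[ℝ] E →L[ℝ] ℝ} {J I : E → E →L[ℝ] E} {V : E → E} {f h : E → ℝ} {U : Set E}

theorem contDiffAt_J_vec (H : IsCalabiOn G J I V f h U) {y : E} (hy : y ∈ U) :
    ContDiffAt ℝ ∞ (fun z => J z (V z)) y :=
  (H.kahler.contDiffAt_end hy).clm_apply (H.contDiffAt_vec hy)

theorem contDiffAt_norm (H : IsCalabiOn G J I V f h U) {y : E} (hy : y ∈ U) :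
    ContDiffAt ℝ ∞ (fun z => G z (V z) (V z)) y :=
  ((H.kahler.contDiffAt hy).clm_apply (H.contDiffAt_vec hy)).clm_apply (H.contDiffAt_vec hy)

theorem contDiffAt_leeCoeff (H : IsCalabiOn G J I V f h U) {y : E} (hy : y ∈ U) :
    ContDiffAt ℝ ∞ (leeCoeff G J V f) y := by
  have hf := H.conf.contDiffAt_factor hy
  have hf' : ContDiffAt ℝ ∞ (fderiv ℝ f) y := hf.fderiv_right (by simp)
  refine ContDiffAt.div ?_ (H.contDiffAt_norm hy) (H.norm_pos hy).ne'
  refine ContDiffAt.clm_apply ?_ (H.contDiffAt_J_vec hy)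
  have h1 : ContDiffAt ℝ ∞ (fun z => 1 / (2 * f z)) y :=
    contDiffAt_const.div (contDiffAt_const.mul hf)
      (mul_ne_zero two_ne_zero (H.conf.pos_factor y hy).ne')
  exact h1.smul hf'

/-- `fderiv_factor_mul` makes `dc` proportional to `dh`; the ratio is found by evaluating at `JV`,
where `dh(JV) = -|V|² ≠ 0`. -/
theorem exists_fderiv_eq (H : IsCalabiOn G J I V f h U) {y : E} (hy : y ∈ U) {F c : E → ℝ}
    (hF : ContDiffAt ℝ ∞ F y) (hc : DifferentiableAt ℝ c y)
    (e : ∀ᶠ z in nhds y, fderiv ℝ F z = c z • fderiv ℝ h z) :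
    ∃ k, ∀ u, fderiv ℝ c y u = k * G y (J y (V y)) u := by
  refine ⟨fderiv ℝ c y (J y (V y)) / G y (V y) (V y), fun u => ?_⟩
  have h1 := fderiv_factor_mul hF (H.contDiffAt_ham hy) hc e u (J y (V y))
  have h2 := H.hamiltonian y hy u
  have h3 := H.hamiltonian y hy (J y (V y))
  rw [H.kahler.orth y hy] at h3
  have hq := (H.norm_pos hy).ne'
  rw [h2]
  field_simp
  rw [h3]
  linarith

variable [FiniteDimensional ℝ E]

theorem contDiffAt_vecCoeff (H : IsCalabiOn G J I V f h U) {y : E} (hy : y ∈ U) :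
    ContDiffAt ℝ ∞ (vecCoeff G J V) y := by
  have hV := H.contDiffAt_vec hy
  have hV' : ContDiffAt ℝ ∞ (fderiv ℝ V) y := hV.fderiv_right (by simp)
  have hc : ContDiffAt ℝ ∞ (fun z => covVec G V z (V z)) y := by
    have : (fun z => covVec G V z (V z)) =
        fun z => fderiv ℝ V z (V z) + christoffelL G z (V z) (V z) := rfl
    rw [this]
    exact (hV'.clm_apply hV).add
      (((H.kahler.contDiffAt_christoffelL hy).clm_apply hV).clm_apply hV)
  exact ((((H.kahler.contDiffAt hy).clm_apply hc).clm_apply (H.contDiffAt_J_vec hy)).div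
    (H.contDiffAt_norm hy) (H.norm_pos hy).ne')

theorem structure_eq (H : IsCalabiOn G J I V f h U) (hd : 2 < Module.finrank ℝ E) {y : E}
    (hy : y ∈ U) :
    (∀ u, halfLogDeriv f y u = leeCoeff G J V f y * G y (J y (V y)) u) ∧
    ∀ u, covVec G V y u =
      ((vecCoeff G J V y + leeCoeff G J V f y * G y (V y) (V y) / 2) / 2) • J y u +
      ((vecCoeff G J V y - leeCoeff G J V f y * G y (V y) (V y) / 2) / 2) • I y u := by
  have := calabi_structure (H.kahler.symm y hy) (H.kahler.pos y hy) (H.ne_zero y hy)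
    (H.kahler.sq y hy) (H.kahler.orth y hy) (H.I_vec y hy) (H.I_J_vec y hy) (H.I_perp y hy)
    (H.exists_perp hy hd) (H.covVec_skew hy) (H.covVec_comm hy) (H.lee_identity hy)
  have e : leeCoeff G J V f y * G y (V y) (V y) = halfLogDeriv f y (J y (V y)) :=
    div_mul_cancel₀ _ (H.norm_pos hy).ne'
  rw [e]
  exact this

/-- `d|V|²(u) = 2G(∇_u V, V) = -2G(u, ∇_V V)`, and `∇_V V` is a multiple of `JV`, which is dual to
`-dh`. -/
theorem fderiv_norm (H : IsCalabiOn G J I V f h U) (hd : 2 < Module.finrank ℝ E) {y : E}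
    (hy : y ∈ U) :
    fderiv ℝ (fun z => G z (V z) (V z)) y = (2 * vecCoeff G J V y) • fderiv ℝ h y := by
  ext u
  have hG := H.kahler.differentiableAt hy
  have hV := H.differentiableAt_vec hy
  have h1 := H.covVec_skew hy u (V y)
  rw [(H.structure_eq hd hy).2 (V y), H.I_vec y hy, ← add_smul, map_smul, smul_eq_mul,
    H.kahler.symm y hy u, H.hamiltonian y hy] at h1
  rw [fderiv_clm_apply_apply (hG.clm_apply hV) hV, fderiv_clm_apply_apply hG hV, add_apply,
    H.kahler.metric_compat hy]
  simp only [covVec, add_apply, ContinuousLinearMap.flip_apply, map_add] at h1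
  rw [H.kahler.symm y hy (V y) (christoffelL G y u (V y)), H.kahler.symm y hy (V y)]
  simp only [smul_apply, smul_eq_mul]
  linarith

theorem exists_fderiv_vecCoeff (H : IsCalabiOn G J I V f h U) (hd : 2 < Module.finrank ℝ E) {y : E}
    (hy : y ∈ U) : ∃ k, ∀ u, fderiv ℝ (vecCoeff G J V) y u = k * G y (J y (V y)) u := by
  have hc : DifferentiableAt ℝ (vecCoeff G J V) y :=
    (H.contDiffAt_vecCoeff hy).differentiableAt (by simp)
  obtain ⟨k, hk⟩ := H.exists_fderiv_eq hy (H.contDiffAt_norm hy) (hc.const_mul 2)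
    (by filter_upwards [H.kahler.isOpen.mem_nhds hy] with z hz using H.fderiv_norm hd hz)
  refine ⟨k / 2, fun u => ?_⟩
  have := hk u
  rw [fderiv_const_mul hc, smul_apply, smul_eq_mul] at this
  linarith

theorem exists_fderiv_leeCoeff (H : IsCalabiOn G J I V f h U) (hd : 2 < Module.finrank ℝ E) {y : E}
    (hy : y ∈ U) : ∃ k, ∀ u, fderiv ℝ (leeCoeff G J V f) y u = k * G y (J y (V y)) u := by
  have hc : DifferentiableAt ℝ (leeCoeff G J V f) y :=
    (H.contDiffAt_leeCoeff hy).differentiableAt (by simp)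
  have hF : ContDiffAt ℝ ∞ (fun z => Real.log (f z)) y :=
    (H.conf.contDiffAt_factor hy).log (H.conf.pos_factor y hy).ne'
  -- The factor is `-2` because `d log f = 2θ = 2t G(JV,·) = -2t dh`.
  obtain ⟨k, hk⟩ := H.exists_fderiv_eq hy hF (hc.const_mul (-2)) (by
    filter_upwards [H.kahler.isOpen.mem_nhds hy] with z hz
    ext u
    have h1 := (H.structure_eq hd hz).1 u
    have hf0 := (H.conf.pos_factor z hz).ne'
    rw [H.hamiltonian z hz, halfLogDeriv] at h1
    rw [fderiv.log ((H.conf.contDiffAt_factor hz).differentiableAt (by simp)) hf0]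
    simp only [smul_apply, smul_eq_mul] at h1 ⊢
    field_simp at h1 ⊢
    linarith)
  refine ⟨-k / 2, fun u => ?_⟩
  have := hk u
  rw [fderiv_const_mul hc, smul_apply, smul_eq_mul] at this
  linarith

/-- The curvature operators applied to the Killing field. -/
theorem exists_curvature_vec (H : IsCalabiOn G J I V f h U) (hd : 2 < Module.finrank ℝ E) {y : E}
    (hy : y ∈ U) : ∃ a b c t : ℝ, ∀ u v w, G y (curvature G y u v (V y)) w =
      a * (G y (J y (V y)) u * G y (J y v) w - G y (J y (V y)) v * G y (J y u) w) +
      b * (G y (J y (V y)) u * G y (I y v) w - G y (J y (V y)) v * G y (I y u) w) +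
      c * (leeTensor (G y) (I y) (t • G y (J y (V y))) u v w -
        leeTensor (G y) (I y) (t • G y (J y (V y))) v u w) := by
  obtain ⟨k, hk⟩ := H.exists_fderiv_vecCoeff hd hy
  obtain ⟨l, hl⟩ := H.exists_fderiv_leeCoeff hd hy
  have hc : DifferentiableAt ℝ (vecCoeff G J V) y :=
    (H.contDiffAt_vecCoeff hy).differentiableAt (by simp)
  have ht : DifferentiableAt ℝ (leeCoeff G J V f) y :=
    (H.contDiffAt_leeCoeff hy).differentiableAt (by simp)
  have hq : DifferentiableAt ℝ (fun z => G z (V z) (V z)) y :=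
    (H.contDiffAt_norm hy).differentiableAt (by simp)
  have htq : DifferentiableAt ℝ (fun z => leeCoeff G J V f z * G z (V z) (V z)) y := ht.mul hq
  -- These are the coefficients of `structure_eq`, written as sums of `l` and `t|V|²` so that their
  -- differentials follow from those of `l`, `t` and `|V|²`.
  set α : E → ℝ := fun z =>
    (1 / 2 : ℝ) * vecCoeff G J V z + (1 / 4 : ℝ) * (leeCoeff G J V f z * G z (V z) (V z)) with hα
  set β : E → ℝ := fun z =>
    (1 / 2 : ℝ) * vecCoeff G J V z - (1 / 4 : ℝ) * (leeCoeff G J V f z * G z (V z) (V z)) with hβ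
  have hα1 : DifferentiableAt ℝ α y := (hc.const_mul _).add (htq.const_mul _)
  have hβ1 : DifferentiableAt ℝ β y := (hc.const_mul _).sub (htq.const_mul _)
  have hμ : ∃ m, ∀ u, fderiv ℝ (fun z => leeCoeff G J V f z * G z (V z) (V z)) y u =
      m * G y (J y (V y)) u := by
    refine ⟨G y (V y) (V y) * l - 2 * leeCoeff G J V f y * vecCoeff G J V y, fun u => ?_⟩
    rw [fderiv_fun_mul ht hq, H.fderiv_norm hd hy]
    simp only [add_apply, smul_apply, smul_eq_mul, hl]
    rw [H.hamiltonian y hy]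
    ring
  obtain ⟨m, hm⟩ := hμ
  have hdα : ∀ u, fderiv ℝ α y u = (k / 2 + m / 4) * G y (J y (V y)) u := by
    intro u
    rw [hα, fderiv_fun_add (hc.const_mul _) (htq.const_mul _), fderiv_const_mul hc,
      fderiv_const_mul htq]
    simp only [add_apply, smul_apply, smul_eq_mul, hk, hm]
    ring
  have hdβ : ∀ u, fderiv ℝ β y u = (k / 2 - m / 4) * G y (J y (V y)) u := by
    intro u
    rw [hβ, fderiv_fun_sub (hc.const_mul _) (htq.const_mul _), fderiv_const_mul hc,
      fderiv_const_mul htq]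
    simp only [sub_apply, smul_apply, smul_eq_mul, hk, hm]
    ring
  have hJ := H.kahler.differentiableAt_end hy
  have hI := H.conf.differentiableAt_end hy
  have hVW : ∀ᶠ z in nhds y, covVec G V z = α z • J z + β z • I z := by
    filter_upwards [H.kahler.isOpen.mem_nhds hy] with z hz
    ext1 u
    rw [(H.structure_eq hd hz).2 u]
    simp only [add_apply, smul_apply, hα, hβ]
    congr 2 <;> ring
  have hθ : halfLogDeriv f y = leeCoeff G J V f y • G y (J y (V y)) := by
    ext u
    exact (H.structure_eq hd hy).1 u
  refine ⟨k / 2 + m / 4, k / 2 - m / 4, β y, leeCoeff G J V f y, fun u v w => ?_⟩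
  have hW : DifferentiableAt ℝ (fun z => α z • J z + β z • I z) y :=
    (hα1.smul hJ).add (hβ1.smul hI)
  rw [H.kahler.curvature_apply_vec hy (H.contDiffAt_vec hy) hW hVW,
    covEnd_combination hα1 hβ1 hJ hI, covEnd_combination hα1 hβ1 hJ hI,
    H.kahler.covEnd_eq_zero rfl hy, H.kahler.covEnd_eq_zero rfl hy, ← hθ,
    ← H.conf.covEnd_eq hy, ← H.conf.covEnd_eq hy, hdα, hdα, hdβ, hdβ]
  simp only [map_sub, map_add, map_smul, sub_apply, add_apply, smul_apply, smul_eq_mul, smul_zero,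
    map_zero, zero_apply]
  ring

/-- On a Kähler surface of Calabi type the holomorphic sectional curvature of `a + b`, with `a` in
the span of `V`, `J V` and `b` orthogonal to it, is a function of the lengths of `a` and `b`. -/
theorem exists_holomorphic (H : IsCalabiOn G J I V f h U) (hd : Module.finrank ℝ E = 4) {y : E}
    (hy : y ∈ U) : ∃ P Q S : ℝ, ∀ a b : E, a ∈ Submodule.span ℝ {V y, J y (V y)} →
      G y b (V y) = 0 → G y b (J y (V y)) = 0 →
      G y (curvature G y (a + b) (J y (a + b)) (J y (a + b))) (a + b) =
        P * G y a a ^ 2 + Q * G y a a * G y b b + S * G y b b ^ 2 := by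
  have hK := H.kahler.isKahlerCurvature hy
  obtain ⟨α, β, c, t, hR⟩ := H.exists_curvature_vec (by omega) hy
  obtain ⟨b₀, hb₀, hb₁, hb₂⟩ := H.exists_perp hy (by omega)
  have hs := H.kahler.symm y hy
  have ho := H.kahler.orth y hy
  have sq := H.kahler.sq y hy
  have sk := H.kahler.skew hy
  have hq := H.norm_pos hy
  have hq0 := H.kahler.pos y hy b₀ hb₀
  have h0 := H.inner_J_vec hy
  have h0' : G y (J y (V y)) (V y) = 0 := by rw [hs, h0]
  have hself : ∀ b, G y (J y b) b = 0 := by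
    intro b
    have h1 := sk b b
    rw [hs b] at h1
    linarith
  set ξ := V y with hξ
  set q := G y ξ ξ with hqdef
  have hIp := H.I_perp y hy
  have hIV := H.I_vec y hy
  have hIJV := H.I_J_vec y hy
  rw [← hξ] at hIV hIJV hIp
  have hpJ : ∀ b, G y b ξ = 0 → G y b (J y ξ) = 0 →
      G y (J y b) ξ = 0 ∧ G y (J y b) (J y ξ) = 0 := fun b h1 h2 => H.perp_J hy h1 h2
  have hflip : ∀ b, G y b ξ = 0 → G y b (J y ξ) = 0 →
      G y ξ b = 0 ∧ G y (J y ξ) b = 0 := fun b h1 h2 => ⟨by rw [hs, h1], by rw [hs, h2]⟩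
  -- The constants are read off from `hR`: in `R(ξ,b,ξ,c)` only the Lee term survives, while
  -- `R(Jξ,b,ξ,c)` also gets `α - β` from the differentials of the coefficients.
  have main := hK.holomorphic_eq (G := fun v w => G y v w) (ξ := ξ) sq ?_ ?_ (c * t * q)
    ((α - β) * q + c * t * q) ?_ ?_ hpJ ho hself ⟨b₀, hq0.ne', hb₁, hb₂⟩ (fun b c => by simp)
  · have hS : ∀ b, G y b ξ = 0 → G y b (J y ξ) = 0 →
        G y (curvature G y b (J y b) (J y b)) b =
          G y (curvature G y b₀ (J y b₀) (J y b₀)) b₀ / G y b₀ b₀ ^ 2 * G y b b ^ 2 := by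
      intro b h1 h2
      obtain ⟨r, s, rfl⟩ := H.exists_eq_perp hy hd hb₀ hb₁ hb₂ h1 h2
      have e := hK.holomorphic_line sq r s b₀
      simp only [ContinuousLinearMap.coe_coe] at e
      rw [e]
      have e2 : G y (r • b₀ + s • J y b₀) (r • b₀ + s • J y b₀) = (r ^ 2 + s ^ 2) * G y b₀ b₀ := by
        simp only [map_add, map_smul, add_apply, smul_apply, smul_eq_mul, ho, hself,
          hs b₀ (J y b₀)]
        ring
      rw [e2]
      field_simp
    -- `P` and `S` are the holomorphic sectional curvatures of the two complex lines; `Q = -8m/|ξ|²`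
    -- with `m = c t |ξ|²`.
    refine ⟨G y (curvature G y ξ (J y ξ) (J y ξ)) ξ / q ^ 2, -8 * (c * t),
      G y (curvature G y b₀ (J y b₀) (J y b₀)) b₀ / G y b₀ b₀ ^ 2, fun a b ha h1 h2 => ?_⟩
    obtain ⟨x, z, rfl⟩ := Submodule.mem_span_pair.1 ha
    have e := main x z b h1 h2
    simp only [ContinuousLinearMap.coe_coe] at e
    have e2 : G y (x • ξ + z • J y ξ) (x • ξ + z • J y ξ) = (x ^ 2 + z ^ 2) * q := by
      simp only [map_add, map_smul, add_apply, smul_apply, smul_eq_mul, ho, h0, h0', ← hqdef]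
      ring
    rw [e, hS b h1 h2, e2]
    field_simp
    ring
  · intro b d e h1 h2 h3 h4 h5 h6
    simp only [hR, leeTensor, hIp b h1 h2, hIp d h3 h4, hIp e h5 h6, hflip b h1 h2, hflip d h3 h4,
      hflip e h5 h6, hflip (J y b) (hpJ b h1 h2).1 (hpJ b h1 h2).2,
      hflip (J y d) (hpJ d h3 h4).1 (hpJ d h3 h4).2, hflip (J y e) (hpJ e h5 h6).1 (hpJ e h5 h6).2,
      smul_apply, smul_eq_mul, map_neg]
    ring
  · intro b h1 h2
    simp only [ContinuousLinearMap.coe_coe, hR, leeTensor, hIp b h1 h2, hIV, hIJV, hflip b h1 h2,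
      hflip (J y b) (hpJ b h1 h2).1 (hpJ b h1 h2).2, h0, h0', sq,
      smul_apply, smul_eq_mul, map_neg, neg_apply]
    ring
  · intro b d h1 h2 h3 h4
    simp only [hR, leeTensor, hIp b h1 h2, hIp d h3 h4, hIV, hflip b h1 h2, hflip d h3 h4,
      hflip (J y b) (hpJ b h1 h2).1 (hpJ b h1 h2).2, ho,
      hflip (J y d) (hpJ d h3 h4).1 (hpJ d h3 h4).2, h0', h1, smul_apply, smul_eq_mul, map_neg,
      neg_apply]
    rw [← hqdef]
    ring
  · intro b d h1 h2 h3 h4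
    simp only [ContinuousLinearMap.coe_coe, hR, leeTensor, hIp b h1 h2, hIp d h3 h4, hIJV,
      hflip b h1 h2, hflip d h3 h4,
      hflip (J y b) (hpJ b h1 h2).1 (hpJ b h1 h2).2, ho, h0', h1, smul_apply, smul_eq_mul, map_neg,
      neg_apply]
    rw [← hqdef, sk b d]
    ring

end IsCalabiOn

end LocalGeom

/-! ### Expressions in charts -/

namespace ManifoldGeom

variable {E : Type*} [NormedAddCommGroup E] [NormedSpace ℝ E]
  {M : Type*} [TopologicalSpace M] [ChartedSpace E M] [IsManifold 𝓘(ℝ, E) ∞ M]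

omit [IsManifold 𝓘(ℝ, E) ∞ M] in
theorem isOpen_chartTarget (p : M) : IsOpen (chartTarget E p) := isOpen_extChartAt_target p

theorem chartFrame_isInvertible {p : M} {y : E} (hy : y ∈ chartTarget E p) :
    (chartFrame p y).IsInvertible := by
  have : IsManifold 𝓘(ℝ, E) 1 M := .of_le (n := ∞) (by simp)
  have h := isInvertible_mfderivWithin_extChartAt_symm (I := 𝓘(ℝ, E)) hy
  rw [modelWithCornersSelf_coe, Set.range_id, mfderivWithin_univ] at h
  exact h

theorem chartFrame_inverse {p : M} {y : E} (hy : y ∈ chartTarget E p) :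
    (chartFrame p y).inverse =
      mfderiv 𝓘(ℝ, E) 𝓘(ℝ, E) (extChartAt 𝓘(ℝ, E) p) (chartInv p y) := by
  have : IsManifold 𝓘(ℝ, E) 1 M := .of_le (n := ∞) (by simp)
  have h := mfderiv_extChartAt_comp_mfderivWithin_extChartAt_symm (I := 𝓘(ℝ, E)) hy
  have h' := mfderivWithin_extChartAt_symm_comp_mfderiv_extChartAt (I := 𝓘(ℝ, E)) hy
  rw [modelWithCornersSelf_coe, Set.range_id, mfderivWithin_univ] at h h'
  exact ContinuousLinearMap.inverse_eq h' h

theorem contMDiffOn_chartInv (p : M) :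
    ContMDiffOn 𝓘(ℝ, E) 𝓘(ℝ, E) ∞ (chartInv p : E → M) (chartTarget E p) :=
  contMDiffOn_extChartAt_symm p

theorem contMDiffOn_chartFrame (p : M) (v : E) :
    ContMDiffOn 𝓘(ℝ, E) (𝓘(ℝ, E).prod 𝓘(ℝ, E)) ∞
      (fun y => Bundle.TotalSpace.mk' E (E := fun x : M => TangentSpace 𝓘(ℝ, E) x)
        (chartInv p y) (chartFrame p y v)) (chartTarget E p) := by
  have ho := isOpen_chartTarget (E := E) p
  have h1 := (contMDiffOn_chartInv (E := E) p).contMDiffOn_tangentMapWithin (m := ∞) (by simp)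
    ho.uniqueMDiffOn
  have h2 : ContMDiffOn 𝓘(ℝ, E) 𝓘(ℝ, E).tangent ∞
      (fun y : E => (⟨y, v⟩ : TangentBundle 𝓘(ℝ, E) E)) (chartTarget E p) :=
    contMDiffOn_vectorSpace_iff_contDiffOn.2 contDiffOn_const
  refine (h1.comp h2 fun y hy => hy).congr fun y hy => ?_
  simp only [Function.comp, tangentMapWithin]
  rw [mfderivWithin_of_isOpen ho hy]
  rfl

/-- The inverse frame is the derivative of the chart, so this is the fibre component of the chart's
tangent map composed with a smooth section. -/
theorem contDiffOn_chartFrame_inverse {p : M} {s : ∀ y : E, TangentSpace 𝓘(ℝ, E) (chartInv p y : M)}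
    (hs : ContMDiffOn 𝓘(ℝ, E) (𝓘(ℝ, E).prod 𝓘(ℝ, E)) ∞
      (fun y => Bundle.TotalSpace.mk' E (E := fun x : M => TangentSpace 𝓘(ℝ, E) x)
        (chartInv p y) (s y)) (chartTarget E p)) :
    ContDiffOn ℝ ∞ (fun y => (chartFrame p y).inverse (s y)) (chartTarget E p) := by
  have ho := isOpen_extChartAt_source (I := 𝓘(ℝ, E)) p
  have hsrc : ContMDiffOn 𝓘(ℝ, E) 𝓘(ℝ, E) ∞ (extChartAt 𝓘(ℝ, E) p) (extChartAt 𝓘(ℝ, E) p).source := by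
    rw [extChartAt_source]
    exact contMDiffOn_extChartAt
  have h1 := hsrc.contMDiffOn_tangentMapWithin (m := ∞) (by simp) ho.uniqueMDiffOn
  have h2 := (contMDiff_snd_tangentBundle_modelSpace (n := ∞) E 𝓘(ℝ, E)).comp_contMDiffOn
    (h1.comp hs fun y hy => (extChartAt 𝓘(ℝ, E) p).map_target hy)
  refine h2.contDiffOn.congr fun y hy => ?_
  rw [chartFrame_inverse hy]
  simp only [Function.comp, tangentMapWithin]
  have e := mfderivWithin_of_isOpen (I := 𝓘(ℝ, E)) (I' := 𝓘(ℝ, E)) (f := extChartAt 𝓘(ℝ, E) p) ho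
    ((extChartAt 𝓘(ℝ, E) p).map_target hy)
  exact DFunLike.congr_fun e.symm (s y)

theorem contDiffOn_vectorInChart {ξ : VField E M} (hξ : SmoothVFieldOn ξ Set.univ) (p : M) :
    ContDiffOn ℝ ∞ (vectorInChart ξ p) (chartTarget E p) :=
  contDiffOn_chartFrame_inverse (hξ.comp (contMDiffOn_chartInv p) fun _ _ => Set.mem_univ _)

theorem contDiffOn_function {f : M → ℝ} (hf : ContMDiff 𝓘(ℝ, E) 𝓘(ℝ, ℝ) ∞ f) (p : M) :
    ContDiffOn ℝ ∞ (fun y : E => f (chartInv p y)) (chartTarget E p) :=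
  (hf.comp_contMDiffOn (contMDiffOn_chartInv p)).contDiffOn

theorem contDiffOn_endInChart [FiniteDimensional ℝ E] {J : EndField E M} (hJ : SmoothEndField J)
    (p : M) : ContDiffOn ℝ ∞ (endInChart J p) (chartTarget E p) := by
  rw [contDiffOn_clm_apply]
  intro v
  refine contDiffOn_chartFrame_inverse (s := fun y => J (chartInv p y) (chartFrame p y v)) ?_
  exact ContMDiffOn.clm_bundle_apply (hJ.comp_contMDiffOn (contMDiffOn_chartInv p))
    (contMDiffOn_chartFrame p v)

theorem contDiffOn_metricInChart [FiniteDimensional ℝ E] (g : SmoothMetric E M) (p : M) :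
    ContDiffOn ℝ ∞ (metricInChart g p) (chartTarget E p) := by
  rw [contDiffOn_clm_apply]
  intro v
  rw [contDiffOn_clm_apply]
  intro w y hy
  have : ContMDiffWithinAt 𝓘(ℝ, E) (𝓘(ℝ, E).prod 𝓘(ℝ)) ∞
      (fun y => Bundle.TotalSpace.mk' ℝ (E := Bundle.Trivial M ℝ) (chartInv p y)
        (g.inner (chartInv p y) (chartFrame p y v) (chartFrame p y w))) (chartTarget E p) y := by
    apply ContMDiffWithinAt.clm_bundle_apply₂ (F₁ := E) (F₂ := E)
    · exact (g.contMDiff.comp_contMDiffOn (contMDiffOn_chartInv p)) y hy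
    · exact contMDiffOn_chartFrame p v y hy
    · exact contMDiffOn_chartFrame p w y hy
  rw [Bundle.contMDiffWithinAt_totalSpace] at this
  exact this.2.contDiffWithinAt

theorem fderiv_function [FiniteDimensional ℝ E] {f : M → ℝ} (hf : ContMDiff 𝓘(ℝ, E) 𝓘(ℝ, ℝ) ∞ f)
    {p : M} {y : E} (hy : y ∈ chartTarget E p) (v : E) :
    fderiv ℝ (fun y : E => f (chartInv p y)) y v =
      mfderiv 𝓘(ℝ, E) 𝓘(ℝ, ℝ) f (chartInv p y) (chartFrame p y v) := by
  have h1 : MDifferentiableAt 𝓘(ℝ, E) 𝓘(ℝ, ℝ) f (chartInv p y) := hf.mdifferentiable (by simp) _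
  have h2 : MDifferentiableAt 𝓘(ℝ, E) 𝓘(ℝ, E) (chartInv p : E → M) y :=
    ((contMDiffOn_chartInv p).contMDiffAt ((isOpen_chartTarget p).mem_nhds hy)).mdifferentiableAt
      (by simp)
  rw [← mfderiv_eq_fderiv]
  have := mfderiv_comp y h1 h2
  exact DFunLike.congr_fun this v

theorem isMetricOn_metricInChart [FiniteDimensional ℝ E] (g : SmoothMetric E M) (p : M) :
    LocalGeom.IsMetricOn (metricInChart g p) (chartTarget E p) where
  isOpen := isOpen_chartTarget p
  smooth := contDiffOn_metricInChart g p
  symm y _ v w := g.symm (chartInv p y) (chartFrame p y v) (chartFrame p y w)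
  pos y hy v hv := by
    refine g.pos (chartInv p y) (chartFrame p y v) fun h => hv ?_
    exact (chartFrame_isInvertible hy).injective (h.trans (map_zero _).symm)

theorem chartFrame_vectorInChart (ξ : VField E M) {p : M} {y : E} (hy : y ∈ chartTarget E p) :
    chartFrame p y (vectorInChart ξ p y) = ξ (chartInv p y) :=
  (chartFrame_isInvertible hy).self_apply_inverse _

theorem chartFrame_endInChart (J : EndField E M) {p : M} {y : E} (hy : y ∈ chartTarget E p) (v : E) :
    chartFrame p y (endInChart J p y v) = J (chartInv p y) (chartFrame p y v) :=
  (chartFrame_isInvertible hy).self_apply_inverse _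

theorem metricInChart_apply (g : SmoothMetric E M) (p : M) (y v w : E) :
    metricInChart g p y v w = g.inner (chartInv p y) (chartFrame p y v) (chartFrame p y w) := rfl

/-- Expressed through `g`, not `g'`, so that `J` (with `f = 1`) and `I` are differentiated by the
same Levi-Civita connection. -/
theorem IsKahler.isConfKahlerOn [FiniteDimensional ℝ E] {g g' : SmoothMetric E M} {J : EndField E M}
    {f : M → ℝ} (hf : ContMDiff 𝓘(ℝ, E) 𝓘(ℝ, ℝ) ∞ f) (pos : ∀ x, 0 < f x)
    (hg : ∀ (x : M) (v w : TangentSpace 𝓘(ℝ, E) x), g'.inner x v w = f x * g.inner x v w)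
    (h : IsKahler g' J) (p : M) :
    LocalGeom.IsConfKahlerOn (metricInChart g p) (endInChart J p) (fun y => f (chartInv p y))
      (chartTarget E p) where
  toIsMetricOn := isMetricOn_metricInChart g p
  smooth_end := contDiffOn_endInChart h.smooth p
  sq y hy v := by
    apply (chartFrame_isInvertible hy).injective
    rw [chartFrame_endInChart J hy, chartFrame_endInChart J hy, h.sq, map_neg]
  orth y hy v w := by
    have h1 := h.orthogonal (chartInv p y) (chartFrame p y v) (chartFrame p y w)
    rw [hg, hg] at h1
    simp only [metricInChart_apply, chartFrame_endInChart J hy]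
    exact mul_left_cancel₀ (pos _).ne' h1
  smooth_factor := contDiffOn_function hf p
  pos_factor y _ := pos _
  integrable := h.integrable p
  closed y hy u v w := by
    rw [← h.closed p y hy u v w]
    congr 1
    ext z a b
    exact (hg _ _ _).symm

end ManifoldGeom

namespace ManifoldGeom

variable {E : Type*} [NormedAddCommGroup E] [NormedSpace ℝ E]
  {M : Type*} [TopologicalSpace M] [ChartedSpace E M] [IsManifold 𝓘(ℝ, E) ∞ M]

/-! ### Expressions in the preferred chart at a point, evaluated at that point -/

/-- The derivative at `x` of the preferred chart at `x`. -/
noncomputable def chartDeriv (x : M) : TangentSpace 𝓘(ℝ, E) x →L[ℝ] E :=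
  mfderiv 𝓘(ℝ, E) 𝓘(ℝ, E) (extChartAt 𝓘(ℝ, E) x) x

omit [IsManifold 𝓘(ℝ, E) ∞ M] in
/-- A statement on tangent vectors in the domain of a chart may be checked in that chart. -/
theorem forall_of_chartTarget {p : M} {P : M → Prop}
    (h : ∀ y ∈ chartTarget E p, P (chartInv p y)) {x : M}
    (hx : x ∈ (extChartAt 𝓘(ℝ, E) p).source) : P x := by
  have := h _ ((extChartAt 𝓘(ℝ, E) p).map_source hx)
  rwa [chartInv, (extChartAt 𝓘(ℝ, E) p).left_inv hx] at this

/-- `chartInv` of the image of `x` equals `x` only propositionally. Proving the identity at every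
point `chartInv x y` and then specialising avoids transport between tangent spaces. -/
theorem metricInChart_chartDeriv (g : SmoothMetric E M) (x : M) (v w : TangentSpace 𝓘(ℝ, E) x) :
    metricInChart g x (extChartAt 𝓘(ℝ, E) x x) (chartDeriv x v) (chartDeriv x w) =
      g.inner x v w := by
  refine forall_of_chartTarget (E := E) (p := x) (P := fun z => ∀ v w : TangentSpace 𝓘(ℝ, E) z,
    metricInChart g x (extChartAt 𝓘(ℝ, E) x z)
      (mfderiv 𝓘(ℝ, E) 𝓘(ℝ, E) (extChartAt 𝓘(ℝ, E) x) z v)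
      (mfderiv 𝓘(ℝ, E) 𝓘(ℝ, E) (extChartAt 𝓘(ℝ, E) x) z w) = g.inner z v w)
    (fun y hy v w => ?_) (mem_extChartAt_source x) v w
  have e : metricInChart g x (extChartAt 𝓘(ℝ, E) x (chartInv x y)) = metricInChart g x y :=
    congrArg _ ((extChartAt 𝓘(ℝ, E) x).right_inv hy)
  refine (DFunLike.congr_fun (DFunLike.congr_fun e _) _).trans ?_
  have key : metricInChart g x y ((chartFrame x y).inverse v) ((chartFrame x y).inverse w) =
      g.inner (chartInv x y) v w := by
    rw [metricInChart_apply, (chartFrame_isInvertible hy).self_apply_inverse,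
      (chartFrame_isInvertible hy).self_apply_inverse]
  rw [chartFrame_inverse hy] at key
  exact key

theorem endInChart_chartDeriv (J : EndField E M) (x : M) (v : TangentSpace 𝓘(ℝ, E) x) :
    endInChart J x (extChartAt 𝓘(ℝ, E) x x) (chartDeriv x v) = chartDeriv x (J x v) := by
  refine forall_of_chartTarget (E := E) (p := x) (P := fun z => ∀ v : TangentSpace 𝓘(ℝ, E) z,
    endInChart J x (extChartAt 𝓘(ℝ, E) x z)
      (mfderiv 𝓘(ℝ, E) 𝓘(ℝ, E) (extChartAt 𝓘(ℝ, E) x) z v) =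
      mfderiv 𝓘(ℝ, E) 𝓘(ℝ, E) (extChartAt 𝓘(ℝ, E) x) z (J z v))
    (fun y hy v => ?_) (mem_extChartAt_source x) v
  have e : endInChart J x (extChartAt 𝓘(ℝ, E) x (chartInv x y)) = endInChart J x y :=
    congrArg _ ((extChartAt 𝓘(ℝ, E) x).right_inv hy)
  refine (DFunLike.congr_fun e _).trans ?_
  have key : endInChart J x y ((chartFrame x y).inverse v) =
      (chartFrame x y).inverse (J (chartInv x y) v) := by
    rw [endInChart, ContinuousLinearMap.comp_apply, ContinuousLinearMap.comp_apply,
      (chartFrame_isInvertible hy).self_apply_inverse]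
  rw [chartFrame_inverse hy] at key
  exact key

theorem vectorInChart_chartDeriv (ξ : VField E M) (x : M) :
    vectorInChart ξ x (extChartAt 𝓘(ℝ, E) x x) = chartDeriv x (ξ x) := by
  refine forall_of_chartTarget (E := E) (p := x) (P := fun z =>
    vectorInChart ξ x (extChartAt 𝓘(ℝ, E) x z) =
      mfderiv 𝓘(ℝ, E) 𝓘(ℝ, E) (extChartAt 𝓘(ℝ, E) x) z (ξ z))
    (fun y hy => ?_) (mem_extChartAt_source x)
  have e : vectorInChart ξ x (extChartAt 𝓘(ℝ, E) x (chartInv x y)) = vectorInChart ξ x y :=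
    congrArg _ ((extChartAt 𝓘(ℝ, E) x).right_inv hy)
  refine e.trans ?_
  rw [vectorInChart, chartFrame_inverse hy]
  rfl

theorem riemann_eq (g : SmoothMetric E M) (x : M) (X Y Z W : TangentSpace 𝓘(ℝ, E) x) :
    riemann g x X Y Z W = metricInChart g x (extChartAt 𝓘(ℝ, E) x x)
      (LocalGeom.curvature (metricInChart g x) (extChartAt 𝓘(ℝ, E) x x) (chartDeriv x X)
        (chartDeriv x Y) (chartDeriv x Z)) (chartDeriv x W) := rfl

/-- A Kähler structure of Calabi type in a chart. -/
theorem isCalabiOn [FiniteDimensional ℝ E] {g g' : SmoothMetric E M} {J I : EndField E M}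
    {ξ : VField E M} {f h : M → ℝ} (hK : IsKahler g J) (hne : ∀ x, ξ x ≠ 0) (hξ : IsKilling g ξ)
    (hh : ContMDiff 𝓘(ℝ, E) 𝓘(ℝ, ℝ) ∞ h)
    (ham : ∀ (x : M) (v : TangentSpace 𝓘(ℝ, E) x),
      g.inner x (J x (ξ x)) v = -(mfderiv 𝓘(ℝ, E) 𝓘(ℝ, ℝ) h x v : ℝ))
    (hI : ∀ (x : M), ∀ v ∈ Submodule.span ℝ {ξ x, J x (ξ x)}, I x v = J x v)
    (hI' : ∀ (x : M) (w : TangentSpace 𝓘(ℝ, E) x),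
      (∀ v ∈ Submodule.span ℝ {ξ x, J x (ξ x)}, g.inner x w v = 0) → I x w = -J x w)
    (hf : ContMDiff 𝓘(ℝ, E) 𝓘(ℝ, ℝ) ∞ f) (pos : ∀ x, 0 < f x)
    (hg : ∀ (x : M) (v w : TangentSpace 𝓘(ℝ, E) x), g'.inner x v w = f x * g.inner x v w)
    (hK' : IsKahler g' I) (p : M) :
    LocalGeom.IsCalabiOn (metricInChart g p) (endInChart J p) (endInChart I p) (vectorInChart ξ p)
      (fun y => f (chartInv p y)) (fun y => h (chartInv p y)) (chartTarget E p) where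
  kahler := hK.isConfKahlerOn (f := fun _ => 1) contMDiff_const (fun _ => one_pos)
    (fun _ _ _ => (one_mul _).symm) p
  conf := hK'.isConfKahlerOn hf pos hg p
  smooth_vec := contDiffOn_vectorInChart hξ.1 p
  ne_zero y hy h0 := by
    apply hne (chartInv p y)
    rw [← chartFrame_vectorInChart ξ hy, h0, map_zero]
  killing := hξ.2 p
  smooth_ham := contDiffOn_function hh p
  hamiltonian y hy v := by
    rw [fderiv_function hh hy, metricInChart_apply, chartFrame_endInChart J hy,
      chartFrame_vectorInChart ξ hy, ham]
    rfl
  I_vec y hy := by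
    apply (chartFrame_isInvertible hy).injective
    rw [chartFrame_endInChart J hy, chartFrame_endInChart I hy, chartFrame_vectorInChart ξ hy]
    exact hI _ _ (Submodule.subset_span (Or.inl rfl))
  I_J_vec y hy := by
    apply (chartFrame_isInvertible hy).injective
    rw [chartFrame_endInChart I hy, chartFrame_endInChart J hy, map_neg,
      chartFrame_vectorInChart ξ hy, hI _ _ (Submodule.subset_span (Or.inr rfl)), hK.sq]
  I_perp y hy b h1 h2 := by
    apply (chartFrame_isInvertible hy).injective
    rw [chartFrame_endInChart I hy, map_neg, chartFrame_endInChart J hy]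
    apply hI'
    intro v hv
    obtain ⟨r, s, rfl⟩ := Submodule.mem_span_pair.1 hv
    rw [metricInChart_apply, chartFrame_vectorInChart ξ hy] at h1
    rw [metricInChart_apply, chartFrame_endInChart J hy, chartFrame_vectorInChart ξ hy] at h2
    rw [map_add, map_smul, map_smul, h1, h2]
    simp

/-- The plane field spanned by `ξ` and `J ξ`. -/
theorem isPlaneDistribution_span {g : SmoothMetric E M} {J : EndField E M} {ξ : VField E M}
    (hJ : IsAlmostHermitian g J) (hne : ∀ x, ξ x ≠ 0) (hξ : SmoothVFieldOn ξ Set.univ) :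
    IsPlaneDistribution fun x => Submodule.span ℝ {ξ x, J x (ξ x)} where
  finrank_eq x := by
    have hli : LinearIndependent ℝ ![ξ x, J x (ξ x)] := by
      rw [LinearIndependent.pair_iff]
      intro s t hst
      have h0 : g.inner x (J x (ξ x)) (ξ x) = 0 := by
        have h1 := hJ.orthogonal x (ξ x) (J x (ξ x))
        rw [hJ.sq, map_neg, g.symm x (ξ x)] at h1
        linarith
      have hpos := (g.pos x (ξ x) (hne x)).ne'
      have e1 := congrArg (fun v => g.inner x v (ξ x)) hst
      have e2 := congrArg (fun v => g.inner x v (J x (ξ x))) hst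
      simp only [map_add, map_smul, add_apply, smul_apply, smul_eq_mul, h0,
        hJ.orthogonal, g.symm x (ξ x) (J x (ξ x)), map_zero, zero_apply, mul_zero, add_zero,
        zero_add, mul_eq_zero, hpos, or_false] at e1 e2
      exact ⟨e1, e2⟩
    have h2 := finrank_span_eq_card hli
    have h3 : Set.range ![ξ x, J x (ξ x)] = {ξ x, J x (ξ x)} := Matrix.range_cons_cons_empty _ _ _
    rw [h3] at h2
    exact h2
  smooth x := by
    refine ⟨Set.univ, ξ, fun x => J x (ξ x), isOpen_univ, Set.mem_univ x, hξ, ?_, fun _ _ => rfl⟩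
    exact ContMDiffOn.clm_bundle_apply (hJ.smooth.contMDiffOn) hξ

end ManifoldGeom

/-! ### From the charts to the manifold -/

/-- Every Kähler surface of Calabi type is a QCH Kähler surface. -/
theorem theorem3 {M : Type*} [TopologicalSpace M] [ChartedSpace (EuclideanSpace ℝ (Fin 4)) M]
    [IsManifold 𝓘(ℝ, EuclideanSpace ℝ (Fin 4)) ∞ M]
    (g : ManifoldGeom.SmoothMetric (EuclideanSpace ℝ (Fin 4)) M)
    (J : ManifoldGeom.EndField (EuclideanSpace ℝ (Fin 4)) M)
    (hK : ManifoldGeom.IsKahler g J) (hC : ManifoldGeom.IsCalabiType g J) :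
    ManifoldGeom.IsQCH g J := by
  obtain ⟨ξ, I, hne, hξ, ⟨h, hh, ham⟩, hI, hI', f, g', hf, pos, hg, hK'⟩ := hC
  refine ⟨fun x => Submodule.span ℝ {ξ x, J x (ξ x)},
    ManifoldGeom.isPlaneDistribution_span hK.toIsAlmostHermitian hne hξ.1, ?_, ?_⟩
  · intro x v hv
    obtain ⟨r, s, rfl⟩ := Submodule.mem_span_pair.1 hv
    rw [map_add, map_smul, map_smul, hK.sq]
    exact Submodule.add_mem _ (Submodule.smul_mem _ _ (Submodule.subset_span (Or.inr rfl)))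
      (Submodule.smul_mem _ _ (Submodule.neg_mem _ (Submodule.subset_span (Or.inl rfl))))
  · have key := fun x : M => (ManifoldGeom.isCalabiOn hK hne hξ hh ham hI hI' hf pos hg hK'
      x).exists_holomorphic (by simp) (mem_extChartAt_target (I := 𝓘(ℝ, EuclideanSpace ℝ (Fin 4))) x)
    choose P Q S hPQS using key
    -- The form from `exists_holomorphic` with `|a|² = r²` and `|b|² = 1 - r²`.
    refine ⟨fun x r => P x * (r ^ 2) ^ 2 + Q x * r ^ 2 * (1 - r ^ 2) + S x * (1 - r ^ 2) ^ 2, ?_⟩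
    rintro x X a b rfl ha hb hunit
    have h1 := hPQS x (ManifoldGeom.chartDeriv x a) (ManifoldGeom.chartDeriv x b)
    rw [ManifoldGeom.vectorInChart_chartDeriv, ManifoldGeom.endInChart_chartDeriv,
      ManifoldGeom.metricInChart_chartDeriv, ManifoldGeom.metricInChart_chartDeriv,
      ManifoldGeom.metricInChart_chartDeriv, ManifoldGeom.metricInChart_chartDeriv,
      ← map_add, ManifoldGeom.endInChart_chartDeriv] at h1
    have ha0 : 0 ≤ g.inner x a a := by
      rcases eq_or_ne a 0 with rfl | h0
      · simp
      · exact (g.pos x a h0).le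
    have hbb : g.inner x b b = 1 - g.inner x a a := by
      have h2 := hb a ha
      have h3 := g.symm x a b
      rw [map_add, map_add, add_apply, add_apply, h3, h2] at hunit
      linarith
    rw [ManifoldGeom.riemann_eq, h1 ?_ (hb _ (Submodule.subset_span (Or.inl rfl)))
      (hb _ (Submodule.subset_span (Or.inr rfl))), hbb]
    · simp only [Real.sq_sqrt ha0]
    · obtain ⟨r, s, rfl⟩ := Submodule.mem_span_pair.1 ha
      exact Submodule.mem_span_pair.2 ⟨r, s, by rw [map_add, map_smul, map_smul]⟩
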